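/- Let $\mathbb F$ be a field containing a non-zero element that is not a root of unity (equivalently, $\mathbb F$ is not an algebraic extension of a finite field; every field of characteristic $0$ qualifies). Let $n\ge 1$ and $\mathbf q=(q_1,\dots,q_{n-1})\in(\mathbb F^*)^{n-1}$, and let $A=\mathbb F_{\mathbf q}[x_1,\dots,x_n]$ be the $\mathbb F$-algebra generated by $x_1,\dots,x_n$ subject to the relations $x_ix_j=q_i\,x_jx_i$ for all $1\le i<j\le n$. Then: (1) $A$ is differentially smooth. (2) $A$ is an iterated skew-polynomial ring $\mathbb F[x_1][x_2;\sigma_2]\cdots[x_n;\sigma_n]$. Precisely, let $A_k$ be the subalgebra generated by $x_1,\dots,x_k$. Then $A_1=\mathbb F[x_1]$ is a polynomial ring, $A_n=A$, and for $1\le k<n$ there is an algebra automorphism $\sigma_{k+1}$ of $A_k$, with $\sigma_{k+1}(x_i)=q_i^{-1}x_i$ for $i\le k$, such that $A_{k+1}=A_k[x_{k+1};\sigma_{k+1}]$; that is, $x_{k+1}r=\sigma_{k+1}(r)x_{k+1}$ for $r\in A_k$, and every element of $A_{k+1}$ is uniquely a left polynomial $\sum_i r_ix_{k+1}^i$ with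 $r_i\in A_k$. Here a differential calculus over an algebra $R$ is a differential graded algebra $(\Omega R=\bigoplus_{m\ge0}\Omega^mR,\,d)$ with $\Omega^0R=R$ and $\Omega^mR=R\,d(R)\cdots d(R)$ ($m$ factors $d(R)$) for all $m$. It is connected if $\ker(d|_R)=\mathbb F$, and $N$-dimensional if $\Omega^NR\ne0$ and $\Omega^mR=0$ for $m>N$. A volume form is an element $\mathsf v\in\Omega^NR$ that freely generates $\Omega^NR$ both as a right and as a left $R$-module; let $\pi_{\mathsf v}:\Omega^NR\to R$ be given by $\pi_{\mathsf v}(\mathsf v r)=r$. An $N$-dimensional calculus is integrable if it has a volume form $\mathsf v$ for which all the maps $\Omega^kR\to\mathrm{Hom}_R(\Omega^{N-k}R,R)$ (right $R$-linear maps), $\gamma\mapsto[\gamma'\mapsto\pi_{\mathsf v}(\gamma\gamma')]$, $0\le k\le N$, are bijective. A finitely generated algebra $R$ is differentially smooth if its Gelfand–Kirillov dimension is an integer $N$ and $R$ has a connected, $N$-dimensional, integrable differential calculus. -/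

import Mathlib

open Filter

universe u v

/-! ### Gelfand-Kirillov dimension -/

/-- For a subspace `V`, the span of `1` and all words of length at most `n` in elements of `V`. -/
def wordSpan (F : Type u) [Field F] {R : Type v} [Ring R] [Algebra F R]
    (V : Submodule F R) (n : ℕ) : Submodule F R :=
  (1 ⊔ V) ^ n

/-- The infimum of the real numbers `t` with `dim V(n) ≤ n ^ t` for all large `n`
(it is `⊤` if there is no such `t`). -/
noncomputable def growthExponent (F : Type u) [Field F] {R : Type v} [Ring R] [Algebra F R]
    (V : Submodule F R) : EReal :=
  ⨅ (t : ℝ) (_ : ∀ᶠ n : ℕ in atTop,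
    (Module.finrank F (wordSpan F V n) : ℝ) ≤ (n : ℝ) ^ t), (t : EReal)

/-- The Gelfand-Kirillov dimension: the supremum, over the affine subalgebras of `R`, of the
growth exponent of a generating subspace. An affine subalgebra with a chosen finite dimensional
generating subspace is the same thing as a finite dimensional subspace `V` of `R`, and the growth
exponent depends only on the subalgebra that `V` generates. -/
noncomputable def GKdim (F : Type u) [Field F] (R : Type v) [Ring R] [Algebra F R] : EReal :=
  ⨆ (V : Submodule F R) (_ : V.FG), growthExponent F V

/-! ### Differential calculi -/

/-- A differential calculus over the `F`-algebra `R` with total algebra `Ω`: a differential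
graded algebra, graded by the natural numbers, with degree zero part `R` (embedded by `ι`),
satisfying the density condition `Ωⁿ = R d(R) ⋯ d(R)`. -/
structure DifferentialCalculus (F : Type u) [Field F] (R : Type v) [Ring R] [Algebra F R]
    (Ω : Type v) [Ring Ω] [Algebra F Ω] where
  /-- the homogeneous components -/
  deg : ℕ → Submodule F Ω
  /-- the components form an algebra grading -/
  graded : GradedAlgebra deg
  /-- the embedding of `R` -/
  ι : R →ₐ[F] Ω
  ι_injective : Function.Injective ι
  range_ι : LinearMap.range ι.toLinearMap = deg 0
  /-- the differential -/
  d : Ω →ₗ[F] Ω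
  d_mem : ∀ n : ℕ, ∀ ω ∈ deg n, d ω ∈ deg (n + 1)
  d_d : ∀ ω : Ω, d (d ω) = 0
  leibniz : ∀ n : ℕ, ∀ ω ∈ deg n, ∀ η : Ω, d (ω * η) = d ω * η + (-1) ^ n * (ω * d η)
  /-- the density condition, with products of subspaces -/
  density : ∀ n : ℕ, deg n = deg 0 * (Submodule.map d (deg 0)) ^ n

namespace DifferentialCalculus

variable {F : Type u} [Field F] {R : Type v} [Ring R] [Algebra F R]
  {Ω : Type v} [Ring Ω] [Algebra F Ω] (C : DifferentialCalculus F R Ω)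

theorem mul_mem {i j k : ℕ} (h : i + j = k) {a b : Ω} (ha : a ∈ C.deg i) (hb : b ∈ C.deg j) :
    a * b ∈ C.deg k := by
  have := C.graded
  exact h ▸ SetLike.mul_mem_graded ha hb

theorem ι_mem (r : R) : C.ι r ∈ C.deg 0 := by
  rw [← C.range_ι]
  exact ⟨r, rfl⟩

/-- `ker (d|_R) = F`. -/
def IsConnected : Prop :=
  LinearMap.ker (C.d ∘ₗ C.ι.toLinearMap) = LinearMap.range (Algebra.linearMap F R)

/-- The calculus has dimension `N`. -/
def HasDimension (N : ℕ) : Prop :=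
  C.deg N ≠ ⊥ ∧ ∀ n : ℕ, N < n → C.deg n = ⊥

/-- The right action `γ ↦ γ r` of `r : R` on `Ωᵐ`. -/
def rightAct {m : ℕ} (γ : C.deg m) (r : R) : C.deg m :=
  ⟨(γ : Ω) * C.ι r, C.mul_mem (add_zero m) γ.2 (C.ι_mem r)⟩

/-- The space `Hom_R(Ωᵐ, R)` of right `R`-linear maps. -/
def RightHom (m : ℕ) : Submodule F (C.deg m →ₗ[F] R) where
  carrier := {φ | ∀ (γ : C.deg m) (r : R), φ (C.rightAct γ r) = φ γ * r}
  add_mem' := by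
    intro φ ψ hφ hψ γ r
    simp only [Set.mem_ofPred_eq] at hφ hψ
    simp [hφ γ r, hψ γ r, add_mul]
  zero_mem' := by
    intro γ r
    simp
  smul_mem' := by
    intro c φ hφ γ r
    simp only [Set.mem_ofPred_eq] at hφ
    simp [hφ γ r]

/-- The map `R → Ωᴺ`, `r ↦ v r`. -/
def rightGen {N : ℕ} (v : C.deg N) : R →ₗ[F] C.deg N where
  toFun r := ⟨(v : Ω) * C.ι r, C.mul_mem (add_zero N) v.2 (C.ι_mem r)⟩
  map_add' r s := by ext; simp [mul_add]
  map_smul' c r := by ext; simp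

/-- The map `R → Ωᴺ`, `r ↦ r v`. -/
def leftGen {N : ℕ} (v : C.deg N) : R →ₗ[F] C.deg N where
  toFun r := ⟨C.ι r * (v : Ω), C.mul_mem (zero_add N) (C.ι_mem r) v.2⟩
  map_add' r s := by ext; simp [add_mul]
  map_smul' c r := by ext; simp

/-- `v` is a free generator of `Ωᴺ` both as a right and as a left `R`-module. -/
def IsVolumeForm {N : ℕ} (v : C.deg N) : Prop :=
  Function.Bijective (C.rightGen v) ∧ Function.Bijective (C.leftGen v)

variable {C}

/-- The co-ordinate isomorphism `π_v : Ωᴺ → R`, `π_v (v r) = r`. -/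
noncomputable def coord {N : ℕ} {v : C.deg N} (hv : C.IsVolumeForm v) : C.deg N ≃ₗ[F] R :=
  (LinearEquiv.ofBijective (C.rightGen v) hv.1).symm

theorem coord_rightAct {N : ℕ} {v : C.deg N} (hv : C.IsVolumeForm v) (γ : C.deg N) (r : R) :
    coord hv (C.rightAct γ r) = coord hv γ * r := by
  obtain ⟨s, rfl⟩ := hv.1.2 γ
  have key : ∀ t : R, coord hv (C.rightGen v t) = t := fun t =>
    (LinearEquiv.ofBijective (C.rightGen v) hv.1).symm_apply_apply t
  have h : C.rightAct (C.rightGen v s) r = C.rightGen v (s * r) := by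
    ext
    simp [rightAct, rightGen, mul_assoc]
  rw [h, key, key]

/-- The map `ℓᵏ : Ωᵏ → Hom_R(Ωᴺ⁻ᵏ, R)`, `γ ↦ [γ' ↦ π_v (γ γ')]`. -/
noncomputable def ell {N : ℕ} {v : C.deg N} (hv : C.IsVolumeForm v) (k : ℕ) (hk : k ≤ N) :
    C.deg k →ₗ[F] C.RightHom (N - k) where
  toFun γ :=
    ⟨{ toFun := fun γ' =>
          coord hv ⟨(γ : Ω) * (γ' : Ω), C.mul_mem (Nat.add_sub_cancel' hk) γ.2 γ'.2⟩
       map_add' := fun a b => by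
          rw [← map_add]
          congr 1
          ext
          simp [mul_add]
       map_smul' := fun c a => by
          rw [RingHom.id_apply, ← map_smul]
          congr 1
          ext
          simp },
     fun γ' r => by
      rw [LinearMap.coe_mk, AddHom.coe_mk, ← coord_rightAct]
      congr 1
      ext
      simp [rightAct, mul_assoc]⟩
  map_add' a b := by
    ext γ'
    simp only [LinearMap.coe_mk, AddHom.coe_mk, Submodule.coe_add, LinearMap.add_apply]
    rw [← map_add]
    congr 1
    ext
    simp [add_mul]
  map_smul' c a := by
    ext γ'
    simp only [LinearMap.coe_mk, AddHom.coe_mk, Submodule.coe_smul, LinearMap.smul_apply,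
      RingHom.id_apply]
    rw [← map_smul]
    congr 1
    ext
    simp

variable (C)

/-- The calculus has a volume `N`-form `v` for which all the maps `ℓᵏ`, `0 ≤ k ≤ N`, are
invertible. (They are bimodule maps, so invertible means bijective.) -/
def IsIntegrable (N : ℕ) : Prop :=
  ∃ (v : C.deg N) (hv : C.IsVolumeForm v), ∀ (k : ℕ) (hk : k ≤ N), Function.Bijective (ell hv k hk)

end DifferentialCalculus

/-- An affine algebra of integer Gelfand-Kirillov dimension `N` is differentially smooth if it has
a connected, `N`-dimensional, integrable differential calculus. (By the density condition the
total algebra of a calculus on `R` is no larger than the universe of `R`.) -/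
def DifferentiallySmooth (F : Type u) [Field F] (R : Type v) [Ring R] [Algebra F R] : Prop :=
  Algebra.FiniteType F R ∧
  ∃ N : ℕ, GKdim F R = (N : EReal) ∧
    ∃ (Ω : Type v) (_ : Ring Ω) (_ : Algebra F Ω) (C : DifferentialCalculus F R Ω),
      C.IsConnected ∧ C.HasDimension N ∧ C.IsIntegrable N

/-! ### Skew-polynomial rings -/

/-- Inside the algebra `A`, the subalgebra `B` is the skew-polynomial ring `R[z; σ]`: one has
`z r = σ(r) z` for `r` in `R`, and every element of `B` is, in a unique way, a left polynomial
`∑ rᵢ zⁱ` with coefficients in `R` (and all these polynomials lie in `B`). -/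
def IsSkewPolynomialRing {F : Type u} [Field F] {A : Type v} [Ring A] [Algebra F A]
    (R : Subalgebra F A) (σ : R ≃ₐ[F] R) (z : A) (B : Subalgebra F A) : Prop :=
  (∀ r : R, z * (r : A) = (σ r : A) * z) ∧
  Function.Injective (fun f : ℕ →₀ R => f.sum fun i r => (r : A) * z ^ i) ∧
  Set.range (fun f : ℕ →₀ R => f.sum fun i r => (r : A) * z ^ i) = (B : Set A)

/-! ### The quantum affine space -/

/-- The relations `xᵢ xⱼ = qᵢ xⱼ xᵢ` for `i < j` (so that `i` is not the last index). -/
inductive QuantumAffineRel (F : Type u) [Field F] (n : ℕ) (q : Fin (n - 1) → Fˣ) :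
    FreeAlgebra F (Fin n) → FreeAlgebra F (Fin n) → Prop
  | comm (i j : Fin n) (h : i < j) :
      QuantumAffineRel F n q (FreeAlgebra.ι F i * FreeAlgebra.ι F j)
        ((q ⟨i.val, by omega⟩ : F) • (FreeAlgebra.ι F j * FreeAlgebra.ι F i))

/-- The algebra `F_q[x₁, …, xₙ]`. -/
def QuantumAffineSpace (F : Type u) [Field F] (n : ℕ) (q : Fin (n - 1) → Fˣ) : Type u :=
  RingQuot (QuantumAffineRel F n q)

namespace QuantumAffineSpace

variable (F : Type u) [Field F] (n : ℕ) (q : Fin (n - 1) → Fˣ)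

noncomputable instance : Ring (QuantumAffineSpace F n q) :=
  inferInstanceAs (Ring (RingQuot (QuantumAffineRel F n q)))

noncomputable instance : Algebra F (QuantumAffineSpace F n q) :=
  inferInstanceAs (Algebra F (RingQuot (QuantumAffineRel F n q)))

/-- The generator `xᵢ`; the indices run from `0` to `n - 1`. -/
noncomputable def x (i : Fin n) : QuantumAffineSpace F n q :=
  RingQuot.mkAlgHom F (QuantumAffineRel F n q) (FreeAlgebra.ι F i)

/-- The subalgebra generated by the first `k` generators. -/
noncomputable def initial (k : ℕ) : Subalgebra F (QuantumAffineSpace F n q) :=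
  Algebra.adjoin F {a | ∃ i : Fin n, i.val < k ∧ a = x F n q i}

end QuantumAffineSpace

/-!
The calculus lives in an explicit algebra with a basis of monomials. Adjoin to the quantum affine
space anticommuting symbols `θ₁, …, θₙ` of square zero, with `θᵢ xᵢ = t xᵢ θᵢ` and
`θᵢ xⱼ = xⱼ θᵢ` for `i ≠ j`, where `t` is not a root of unity. The result, `LogForms`, is the
algebra with basis the monomials `x ^ a θ_S` and structure constants a cocycle that is zero when
`S` and `T` meet (`structConst_cocycle`). Let `θ = θ₁ + ⋯ + θₙ`. Since `θ ^ 2 = 0`, the graded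
commutator with `θ` is a differential that satisfies the Leibniz rule (`diff_diff`, `diff_mul`), and

  `d (x ^ a θ_S) = ∑ (t ^ aᵢ - 1) x ^ a θᵢ θ_S`, the sum over the `i` outside `S` (`diff_mono`).

In particular `d xᵢ = (t - 1) xᵢ θᵢ`, so that `θᵢ` is a logarithmic differential. The factor
`t ^ aᵢ - 1` is zero for `aᵢ = 0`; hence `d` preserves the subalgebra `forms` spanned by the
monomials `x ^ a θ_S` in which `xᵢ` occurs whenever `θᵢ` does. This subalgebra is the calculus.

* Density holds because every monomial of `forms` is a multiple of some `x ^ b` times a product of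
  elements `xᵢ θᵢ` (`formDeg_eq_mul_pow`).
* The calculus is connected because `t ^ aᵢ = 1` only for `aᵢ = 0` (`isConnected_calculus`). This is
  where `t` must not be a root of unity.
* The form `x₁ ⋯ xₙ θ₁ ⋯ θₙ` is a volume form, because multiplication by it on either side takes
  the monomials `x ^ a` to nonzero multiples of the monomials of degree `n` (`isVolumeForm`).
* For integrability, the forms `x_T θ_T` with `T` of size `n - k` generate the right module of
  forms of degree `n - k`, and multiplication by `x_T θ_T` kills all monomials `x ^ a θ_S` of degree
  `k` except those with `S` the complement of `T`. So the components of a `k`-form can be read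
  off, and prescribed, one at a time (`ell_injective`, `ell_surjective`).

The iterated skew-polynomial structure and the linear independence of the ordered monomials are
obtained together. The left polynomials in `xₖ` over the subalgebra of the preceding generators are
stable under left multiplication by the generators, and hence fill the next subalgebra
(`range_leftPoly`); comparison of the coefficients of their images in `LogForms` shows that they
are unique, and by induction that the quantum affine space embeds in `LogForms`
(`eq_zero_of_toForms_leftPoly`, `toForms_injective`).

The Gelfand-Kirillov dimension is `n` because the words of length `m` in a finite dimensional
subspace lie in the span of the monomials with all exponents at most `s m`, for a constant `s`,
while the words in the generators reach all monomials of total degree `m` (`GKdim_eq`).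
-/

/-! ### Monomials -/

/-- An index `(a, S)` stands for the monomial `x ^ a θ_S`. -/
abbrev MonoIdx (n : ℕ) : Type := (Fin n → ℕ) × Finset (Fin n)

/-- The algebra of logarithmic forms: the vector space with basis the monomials `x ^ a θ_S`, where
`x ^ a` is, up to a scalar, the product `x₁ ^ a₁ ⋯ xₙ ^ aₙ` (the scalar is `1` if `Q i j = 1` for
`i ≤ j`) and `θ_S` is the product of the `θᵢ` with `i` in `S`, in increasing order. Here
`θᵢ` plays the role of `xᵢ⁻¹ d xᵢ`, up to a scalar. The matrix `Q` and the scalar `t` enter in the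
multiplication only, through `xᵢ xⱼ = Q i j x ^ (εᵢ + εⱼ)`, with `εᵢ` the `i`-th unit vector,
`θᵢ xᵢ = t xᵢ θᵢ`, `θᵢ xⱼ = xⱼ θᵢ` for `i ≠ j`, `θᵢ θⱼ = - θⱼ θᵢ` and `θᵢ ^ 2 = 0`. -/
def LogForms {F : Type u} [Field F] {n : ℕ} (_Q : Fin n → Fin n → Fˣ) (_t : Fˣ) : Type u :=
  MonoIdx n →₀ F

namespace LogForms

variable {F : Type u} [Field F] {n : ℕ} {Q : Fin n → Fin n → Fˣ} {t : Fˣ}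

noncomputable instance : AddCommGroup (LogForms Q t) :=
  inferInstanceAs (AddCommGroup (MonoIdx n →₀ F))

noncomputable instance : Module F (LogForms Q t) :=
  inferInstanceAs (Module F (MonoIdx n →₀ F))

/-- The coordinates with respect to the monomials. -/
noncomputable def coeff : LogForms Q t ≃ₗ[F] (MonoIdx n →₀ F) := LinearEquiv.refl F _

variable (Q t) in
/-- The monomial `x ^ a θ_S`. -/
noncomputable def mono (m : MonoIdx n) : LogForms Q t := coeff.symm (Finsupp.single m 1)

theorem coeff_mono (m : MonoIdx n) : coeff (mono Q t m) = Finsupp.single m 1 := rfl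

theorem eq_sum_mono (f : LogForms Q t) : f = (coeff f).sum fun m r => r • mono Q t m := by
  apply coeff.injective
  rw [Finsupp.sum, map_sum]
  simp only [map_smul, coeff_mono, Finsupp.smul_single, smul_eq_mul, mul_one]
  exact (Finsupp.sum_single (coeff f)).symm

theorem ext_mono {V : Type*} [AddCommMonoid V] [Module F V] {φ ψ : LogForms Q t →ₗ[F] V}
    (h : ∀ m, φ (mono Q t m) = ψ (mono Q t m)) : φ = ψ := by
  ext f
  rw [eq_sum_mono f, Finsupp.sum, map_sum, map_sum]
  simp only [map_smul, h]

/-- The linear map with prescribed values on the monomials. -/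
noncomputable def lift {V : Type*} [AddCommMonoid V] [Module F V] (v : MonoIdx n → V) :
    LogForms Q t →ₗ[F] V :=
  Finsupp.linearCombination F v ∘ₗ coeff.toLinearMap

@[simp] theorem lift_mono {V : Type*} [AddCommMonoid V] [Module F V] (v : MonoIdx n → V)
    (m : MonoIdx n) : lift v (mono Q t m) = v m := by
  simp [lift, coeff_mono]

/-! ### The structure constants -/

theorem sub_single_add_single {a : Fin n → ℕ} {i : Fin n} (h : a i ≠ 0) :
    a - Pi.single i 1 + Pi.single i 1 = a := by
  ext j
  by_cases hj : j = i
  · subst hj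
    simp only [Pi.add_apply, Pi.sub_apply, Pi.single_eq_same]
    omega
  · simp [Pi.single_eq_of_ne hj]

/-- The scalar in `x ^ a x ^ b = bichar Q a b x ^ (a + b)`. -/
def bichar (Q : Fin n → Fin n → Fˣ) (a b : Fin n → ℕ) : Fˣ :=
  ∏ i, ∏ j, Q i j ^ (a i * b j)

theorem bichar_add_left (a a' b : Fin n → ℕ) :
    bichar Q (a + a') b = bichar Q a b * bichar Q a' b := by
  simp [bichar, add_mul, pow_add, Finset.prod_mul_distrib]

theorem bichar_add_right (a b b' : Fin n → ℕ) :
    bichar Q a (b + b') = bichar Q a b * bichar Q a b' := by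
  simp [bichar, mul_add, pow_add, Finset.prod_mul_distrib]

@[simp] theorem bichar_zero_left (b : Fin n → ℕ) : bichar Q 0 b = 1 := by simp [bichar]

@[simp] theorem bichar_zero_right (b : Fin n → ℕ) : bichar Q b 0 = 1 := by simp [bichar]

theorem bichar_single (i j : Fin n) (r s : ℕ) :
    bichar Q (Pi.single i r) (Pi.single j s) = Q i j ^ (r * s) := by
  rw [bichar, Finset.prod_eq_single i, Finset.prod_eq_single j]
  · simp
  · intro l _ hl
    simp [Pi.single_eq_of_ne hl]
  · simp
  · intro l _ hl
    simp [Pi.single_eq_of_ne hl]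
  · simp

/-- The sign of the transposition of `θᵢ` and `θⱼ` that is needed to sort `θᵢ θⱼ`. -/
def swapSign (i j : Fin n) : Fˣ := if j < i then -1 else 1

theorem swapSign_comm {i j : Fin n} (h : i ≠ j) :
    swapSign (F := F) i j = -swapSign j i := by
  rcases lt_or_gt_of_ne h with h | h <;> simp [swapSign, h, not_lt_of_gt h]

/-- The invertible factor in the product of `x ^ a θ_S` and `x ^ b θ_T` for disjoint `S`, `T`. -/
def twist (Q : Fin n → Fin n → Fˣ) (t : Fˣ) (m m' : MonoIdx n) : Fˣ :=
  bichar Q m.1 m'.1 * (∏ i ∈ m.2, t ^ m'.1 i) * ∏ i ∈ m.2, ∏ j ∈ m'.2, swapSign i j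

/-- The structure constants with respect to the monomials; they are zero when some `θᵢ` would
be squared. -/
def structConst (Q : Fin n → Fin n → Fˣ) (t : Fˣ) (m m' : MonoIdx n) : F :=
  if Disjoint m.2 m'.2 then (twist Q t m m' : F) else 0

theorem structConst_ne_zero_of_disjoint {m m' : MonoIdx n} (h : Disjoint m.2 m'.2) :
    structConst Q t m m' ≠ 0 := by
  rw [structConst, if_pos h]
  exact Units.ne_zero _

/-- The index of the product of two monomials. -/
def idxMul (m m' : MonoIdx n) : MonoIdx n := (m.1 + m'.1, m.2 ∪ m'.2)

theorem idxMul_assoc (m m' m'' : MonoIdx n) :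
    idxMul (idxMul m m') m'' = idxMul m (idxMul m' m'') := by
  simp [idxMul, add_assoc, Finset.union_assoc]

theorem twist_idxMul_left {m m' : MonoIdx n} (h : Disjoint m.2 m'.2) (m'' : MonoIdx n) :
    twist Q t (idxMul m m') m'' = twist Q t m m'' * twist Q t m' m'' := by
  simp only [twist, idxMul, bichar_add_left, Finset.prod_union h]
  simp only [mul_assoc, mul_comm, mul_left_comm]

theorem twist_idxMul_right {m' m'' : MonoIdx n} (h : Disjoint m'.2 m''.2) (m : MonoIdx n) :
    twist Q t m (idxMul m' m'') = twist Q t m m' * twist Q t m m'' := by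
  simp only [twist, idxMul, bichar_add_right, Finset.prod_union h, Pi.add_apply, pow_add,
    Finset.prod_mul_distrib]
  simp only [mul_assoc, mul_comm, mul_left_comm]

/-- The cocycle identity, which is the associativity of the product on monomials. -/
theorem structConst_cocycle (m m' m'' : MonoIdx n) :
    structConst Q t m m' * structConst Q t (idxMul m m') m'' =
      structConst Q t m' m'' * structConst Q t m (idxMul m' m'') := by
  by_cases h1 : Disjoint m.2 m'.2
  · by_cases h2 : Disjoint m'.2 m''.2
    · by_cases h3 : Disjoint m.2 m''.2
      · have h4 : Disjoint (idxMul m m').2 m''.2 := Finset.disjoint_union_left.2 ⟨h3, h2⟩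
        have h5 : Disjoint m.2 (idxMul m' m'').2 := Finset.disjoint_union_right.2 ⟨h1, h3⟩
        simp only [structConst, h1, h2, h4, h5, if_true, twist_idxMul_left h1,
          twist_idxMul_right h2, Units.val_mul]
        ring
      · have h4 : ¬ Disjoint (idxMul m m').2 m''.2 := fun h =>
          h3 (Finset.disjoint_union_left.1 h).1
        have h5 : ¬ Disjoint m.2 (idxMul m' m'').2 := fun h =>
          h3 (Finset.disjoint_union_right.1 h).2
        simp [structConst, h4, h5]
    · have h4 : ¬ Disjoint (idxMul m m').2 m''.2 := fun h =>
        h2 (Finset.disjoint_union_left.1 h).2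
      simp [structConst, h4, h2]
  · have h5 : ¬ Disjoint m.2 (idxMul m' m'').2 := fun h =>
      h1 (Finset.disjoint_union_right.1 h).1
    simp [structConst, h1, h5]

/-! ### The algebra of logarithmic forms -/

/-- The multiplication as a bilinear map. -/
noncomputable def mulHom : LogForms Q t →ₗ[F] LogForms Q t →ₗ[F] LogForms Q t :=
  lift fun m => lift fun m' => structConst Q t m m' • mono Q t (idxMul m m')

noncomputable instance : Mul (LogForms Q t) := ⟨fun f g => mulHom f g⟩

noncomputable instance : One (LogForms Q t) := ⟨mono Q t (0, ∅)⟩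

theorem one_def : (1 : LogForms Q t) = mono Q t (0, ∅) := rfl

theorem mul_def (f g : LogForms Q t) : f * g = mulHom f g := rfl

theorem mono_mul_mono (m m' : MonoIdx n) :
    mono Q t m * mono Q t m' = structConst Q t m m' • mono Q t (idxMul m m') := by
  simp [mul_def, mulHom]

theorem span_mono : Submodule.span F (Set.range (mono Q t)) = ⊤ := by
  refine eq_top_iff.2 fun f _ => ?_
  rw [eq_sum_mono f]
  exact Submodule.sum_mem _ fun m _ => Submodule.smul_mem _ _ (Submodule.subset_span ⟨m, rfl⟩)

@[elab_as_elim]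
theorem induction {P : LogForms Q t → Prop} (f : LogForms Q t) (hm : ∀ m, P (mono Q t m))
    (ha : ∀ f g, P f → P g → P (f + g)) (hs : ∀ (r : F) f, P f → P (r • f)) : P f := by
  have hf : f ∈ Submodule.span F (Set.range (mono Q t)) := by rw [span_mono]; trivial
  induction hf using Submodule.span_induction with
  | mem x h => obtain ⟨m, rfl⟩ := h; exact hm m
  | zero => simpa using hs 0 _ (hm (0, ∅))
  | add f g _ _ hf hg => exact ha f g hf hg
  | smul r f _ hf => exact hs r f hf

theorem mulHom_assoc (f g h : LogForms Q t) :
    mulHom (mulHom f g) h = mulHom f (mulHom g h) := by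
  induction f using induction with
  | ha f f' h1 h2 => simp only [map_add, LinearMap.add_apply, h1, h2]
  | hs r f h1 => simp only [map_smul, LinearMap.smul_apply, h1]
  | hm m =>
  induction g using induction with
  | ha f f' h1 h2 => simp only [map_add, LinearMap.add_apply, h1, h2]
  | hs r f h1 => simp only [map_smul, LinearMap.smul_apply, h1]
  | hm m' =>
  induction h using induction with
  | ha f f' h1 h2 => simp only [map_add, h1, h2]
  | hs r f h1 => simp only [map_smul, h1]
  | hm m'' =>
  simp only [← mul_def, mono_mul_mono]
  simp only [mul_def, map_smul, LinearMap.smul_apply]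
  simp only [← mul_def, mono_mul_mono, smul_smul, structConst_cocycle, idxMul_assoc]

theorem one_mulHom (f : LogForms Q t) : mulHom 1 f = f := by
  induction f using induction with
  | ha f f' h1 h2 => simp only [map_add, h1, h2]
  | hs r f h1 => simp only [map_smul, h1]
  | hm m =>
  rw [← mul_def, one_def, mono_mul_mono]
  simp [structConst, idxMul, twist]

theorem mulHom_one (f : LogForms Q t) : mulHom f 1 = f := by
  induction f using induction with
  | ha f f' h1 h2 => simp only [map_add, LinearMap.add_apply, h1, h2]
  | hs r f h1 => simp only [map_smul, LinearMap.smul_apply, h1]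
  | hm m =>
  rw [← mul_def, one_def, mono_mul_mono]
  simp [structConst, idxMul, twist]

noncomputable instance : Ring (LogForms Q t) :=
  { (inferInstance : AddCommGroup (LogForms Q t)),
    (inferInstance : Mul (LogForms Q t)),
    (inferInstance : One (LogForms Q t)) with
    left_distrib := fun f g h => map_add (mulHom f) g h
    right_distrib := fun f g h => by
      simp only [mul_def, map_add, LinearMap.add_apply]
    zero_mul := fun f => by simp only [mul_def, map_zero, LinearMap.zero_apply]
    mul_zero := fun f => map_zero (mulHom f)
    mul_assoc := mulHom_assoc
    one_mul := one_mulHom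
    mul_one := mulHom_one }

noncomputable instance : Algebra F (LogForms Q t) :=
  Algebra.ofModule (fun r f g => by simp only [mul_def, map_smul, LinearMap.smul_apply])
    (fun r f g => by simp only [mul_def, map_smul])

/-! ### Subspaces spanned by monomials -/

variable (Q t) in
/-- The space spanned by the monomials with index in `s`. -/
noncomputable def spanOn (s : Set (MonoIdx n)) : Submodule F (LogForms Q t) :=
  Submodule.span F (mono Q t '' s)

theorem mono_mem_spanOn {s : Set (MonoIdx n)} {m : MonoIdx n} (h : m ∈ s) :
    mono Q t m ∈ spanOn Q t s :=
  Submodule.subset_span ⟨m, h, rfl⟩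

theorem spanOn_mono {s s' : Set (MonoIdx n)} (h : s ⊆ s') : spanOn Q t s ≤ spanOn Q t s' :=
  Submodule.span_mono (Set.image_mono h)

theorem mem_spanOn_iff {s : Set (MonoIdx n)} {f : LogForms Q t} :
    f ∈ spanOn Q t s ↔ ∀ m, coeff f m ≠ 0 → m ∈ s := by
  constructor
  · intro hf
    induction hf using Submodule.span_induction with
    | mem x h =>
      obtain ⟨m, hm, rfl⟩ := h
      intro m' hm'
      rw [coeff_mono, Finsupp.single_apply] at hm'
      split_ifs at hm' with h
      · exact h ▸ hm
      · exact absurd rfl hm'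
    | zero => intro m hm; simp at hm
    | add f g _ _ hf hg =>
      intro m hm
      by_contra hms
      have h1 := not_not.1 fun h => hms (hf m h)
      have h2 := not_not.1 fun h => hms (hg m h)
      simp [h1, h2] at hm
    | smul r f _ hf =>
      intro m hm
      refine hf m fun h => hm ?_
      simp [h]
  · intro h
    rw [eq_sum_mono f]
    exact Submodule.sum_mem _ fun m hm =>
      Submodule.smul_mem _ _ (mono_mem_spanOn (h m (Finsupp.mem_support_iff.1 hm)))

theorem mem_spanOn_inter {s s' : Set (MonoIdx n)} {f : LogForms Q t} (h : f ∈ spanOn Q t s)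
    (h' : f ∈ spanOn Q t s') : f ∈ spanOn Q t (s ∩ s') :=
  mem_spanOn_iff.2 fun m hm => ⟨mem_spanOn_iff.1 h m hm, mem_spanOn_iff.1 h' m hm⟩

theorem map_mem_of_mono {V : Type*} [AddCommMonoid V] [Module F V] (φ : LogForms Q t →ₗ[F] V)
    (W : Submodule F V) {s : Set (MonoIdx n)} (h : ∀ m ∈ s, φ (mono Q t m) ∈ W)
    {f : LogForms Q t} (hf : f ∈ spanOn Q t s) : φ f ∈ W := by
  have : spanOn Q t s ≤ W.comap φ := by
    refine Submodule.span_le.2 ?_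
    rintro _ ⟨m, hm, rfl⟩
    exact h m hm
  exact this hf

theorem map_eq_of_mono {V : Type*} [AddCommGroup V] [Module F V] {φ ψ : LogForms Q t →ₗ[F] V}
    {s : Set (MonoIdx n)} (h : ∀ m ∈ s, φ (mono Q t m) = ψ (mono Q t m))
    {f : LogForms Q t} (hf : f ∈ spanOn Q t s) : φ f = ψ f := by
  have := map_mem_of_mono (φ - ψ) ⊥ (s := s) (fun m hm => by simp [h m hm]) hf
  simpa [sub_eq_zero] using this

/-- Only the products with a nonzero structure constant matter. -/
theorem mul_mem_spanOn {s s' s'' : Set (MonoIdx n)}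
    (h : ∀ m ∈ s, ∀ m' ∈ s', Disjoint m.2 m'.2 → idxMul m m' ∈ s'') {f g : LogForms Q t}
    (hf : f ∈ spanOn Q t s) (hg : g ∈ spanOn Q t s') : f * g ∈ spanOn Q t s'' := by
  refine map_mem_of_mono (LinearMap.mulRight F g) _ (fun m hm => ?_) hf
  refine map_mem_of_mono (LinearMap.mulLeft F (mono Q t m)) _ (fun m' hm' => ?_) hg
  rw [LinearMap.mulLeft_apply, mono_mul_mono]
  by_cases hd : Disjoint m.2 m'.2
  · exact Submodule.smul_mem _ _ (mono_mem_spanOn (h m hm m' hm' hd))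
  · simp [structConst, hd]

/-! ### Monomial maps -/

/-- A coefficient of the image of `f` under a map that takes monomials to multiples of
monomials, when only one monomial of `f` contributes to it. -/
theorem coeff_monomialMap {φ : LogForms Q t →ₗ[F] LogForms Q t} {g : MonoIdx n → MonoIdx n}
    {w : MonoIdx n → F} {s : Set (MonoIdx n)}
    (hφ : ∀ m ∈ s, φ (mono Q t m) = w m • mono Q t (g m))
    {f : LogForms Q t} (hf : f ∈ spanOn Q t s) {m : MonoIdx n}
    (hg : ∀ m' ∈ s, w m' ≠ 0 → g m' = g m → m' = m) (hm : m ∈ s) :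
    coeff (φ f) (g m) = w m * coeff f m := by
  refine map_eq_of_mono (φ := Finsupp.lapply (g m) ∘ₗ coeff.toLinearMap ∘ₗ φ)
    (ψ := w m • (Finsupp.lapply m ∘ₗ coeff.toLinearMap)) (fun m' hm' => ?_) hf
  simp only [LinearMap.comp_apply, hφ m' hm', map_smul, LinearEquiv.coe_coe, coeff_mono,
    Finsupp.lapply_apply, LinearMap.smul_apply, smul_eq_mul]
  by_cases h : m' = m
  · subst h; simp
  · by_cases hw : w m' = 0
    · simp [hw, Finsupp.single_apply, h]
    · have hne : g m' ≠ g m := fun h' => h (hg m' hm' hw h')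
      simp [h, hne]

/-- A monomial map with invertible coefficients takes the span of a set of monomials onto the
span of the image. -/
theorem exists_preimage_monomialMap {φ : LogForms Q t →ₗ[F] LogForms Q t}
    {g : MonoIdx n → MonoIdx n} {w : MonoIdx n → F} {s : Set (MonoIdx n)}
    (hφ : ∀ m ∈ s, φ (mono Q t m) = w m • mono Q t (g m)) (hw : ∀ m ∈ s, w m ≠ 0)
    {f : LogForms Q t} (hf : f ∈ spanOn Q t (g '' s)) : ∃ f' ∈ spanOn Q t s, φ f' = f := by
  have : spanOn Q t (g '' s) ≤ (spanOn Q t s).map φ := by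
    refine Submodule.span_le.2 ?_
    rintro _ ⟨_, ⟨m, hm, rfl⟩, rfl⟩
    refine ⟨(w m)⁻¹ • mono Q t m, Submodule.smul_mem _ _ (mono_mem_spanOn hm), ?_⟩
    rw [map_smul, hφ m hm, smul_smul, inv_mul_cancel₀ (hw m hm), one_smul]
  exact this hf

/-- A monomial map that is injective on indices and has invertible coefficients is injective. -/
theorem eq_zero_of_monomialMap {φ : LogForms Q t →ₗ[F] LogForms Q t}
    {g : MonoIdx n → MonoIdx n} {w : MonoIdx n → F} {s : Set (MonoIdx n)}
    (hφ : ∀ m ∈ s, φ (mono Q t m) = w m • mono Q t (g m)) (hw : ∀ m ∈ s, w m ≠ 0)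
    (hg : Set.InjOn g s) {f : LogForms Q t} (hf : f ∈ spanOn Q t s) (h : φ f = 0) : f = 0 := by
  apply coeff.injective
  ext m
  by_contra hm
  rw [map_zero, Finsupp.zero_apply] at hm
  have hms := mem_spanOn_iff.1 hf m hm
  have := coeff_monomialMap hφ hf (fun m' hm' _ h' => hg hm' hms h') hms
  rw [h, map_zero, Finsupp.zero_apply] at this
  exact mul_ne_zero (hw m hms) hm this.symm

end LogForms

namespace QuantumAffineSpace

open LogForms

variable {F : Type u} [Field F] {n : ℕ} {q : Fin (n - 1) → Fˣ} {t : Fˣ}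

/-! ### Generators of the quantum affine space -/

theorem x_mul_x {i j : Fin n} (h : i < j) :
    x F n q i * x F n q j = (q ⟨i.val, by omega⟩ : F) • (x F n q j * x F n q i) := by
  have := RingQuot.mkAlgHom_rel F (QuantumAffineRel.comm (q := q) i j h)
  rw [map_mul, map_smul, map_mul] at this
  exact this

/-- The universal property. -/
noncomputable def liftHom {B : Type v} [Ring B] [Algebra F B] (y : Fin n → B)
    (hy : ∀ (i j : Fin n) (_ : i < j), y i * y j = (q ⟨i.val, by omega⟩ : F) • (y j * y i)) :
    QuantumAffineSpace F n q →ₐ[F] B :=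
  RingQuot.liftAlgHom F ⟨FreeAlgebra.lift F y, by
    rintro _ _ ⟨i, j, h⟩
    simpa using hy i j h⟩

@[simp] theorem liftHom_x {B : Type v} [Ring B] [Algebra F B] (y : Fin n → B)
    (hy : ∀ (i j : Fin n) (_ : i < j), y i * y j = (q ⟨i.val, by omega⟩ : F) • (y j * y i))
    (i : Fin n) : liftHom y hy (x F n q i) = y i := by
  have := RingQuot.liftAlgHom_mkAlgHom_apply F (FreeAlgebra.lift F y) (s := QuantumAffineRel F n q)
    (by rintro _ _ ⟨i, j, h⟩; simpa using hy i j h) (FreeAlgebra.ι F i)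
  rw [FreeAlgebra.lift_ι_apply] at this
  exact this

variable (F n q) in
theorem adjoin_range_x : Algebra.adjoin F (Set.range (x F n q)) = ⊤ := by
  have h1 : (⊤ : Subalgebra F (FreeAlgebra F (Fin n))).map
      (RingQuot.mkAlgHom F (QuantumAffineRel F n q)) = ⊤ := by
    rw [Algebra.map_top]
    exact AlgHom.range_eq_top _ |>.2 (RingQuot.mkAlgHom_surjective F _)
  rw [← FreeAlgebra.adjoin_range_ι, AlgHom.map_adjoin, ← Set.range_comp] at h1
  exact h1

theorem algHom_ext {B : Type v} [Ring B] [Algebra F B] {φ ψ : QuantumAffineSpace F n q →ₐ[F] B}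
    (h : ∀ i, φ (x F n q i) = ψ (x F n q i)) : φ = ψ := by
  refine AlgHom.ext_of_adjoin_eq_top (adjoin_range_x F n q) ?_
  rintro _ ⟨i, rfl⟩
  exact h i

theorem x_mem_initial {k : ℕ} {i : Fin n} (h : i.val < k) : x F n q i ∈ initial F n q k :=
  Algebra.subset_adjoin ⟨i, h, rfl⟩

variable (F n q) in
theorem initial_zero : initial F n q 0 = ⊥ := by
  simp [initial]

variable (F n q) in
theorem initial_eq_top : initial F n q n = ⊤ := by
  rw [← adjoin_range_x F n q, initial]
  congr 1
  ext a
  constructor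
  · rintro ⟨i, -, rfl⟩; exact ⟨i, rfl⟩
  · rintro ⟨i, rfl⟩; exact ⟨i, i.2, rfl⟩

variable (F n q) in
theorem initial_one (hn : 1 ≤ n) : initial F n q 1 = Algebra.adjoin F {x F n q ⟨0, hn⟩} := by
  rw [initial]
  congr 1
  ext a
  constructor
  · rintro ⟨i, hi, rfl⟩
    have : i = ⟨0, hn⟩ := Fin.ext (by simpa using hi)
    rw [this]; rfl
  · rintro rfl; exact ⟨_, Nat.one_pos, rfl⟩

variable (F n q) in
theorem initial_mono {k l : ℕ} (h : k ≤ l) : initial F n q k ≤ initial F n q l :=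
  Algebra.adjoin_mono fun _ ⟨i, hi, hx⟩ => ⟨i, hi.trans_le h, hx⟩

/-! ### Diagonal automorphisms -/

/-- The endomorphism that multiplies the `i`-th generator by `l i`. -/
noncomputable def scale (l : Fin n → Fˣ) :
    QuantumAffineSpace F n q →ₐ[F] QuantumAffineSpace F n q :=
  liftHom (fun i => (l i : F) • x F n q i) fun i j h => by
    rw [smul_mul_smul_comm, smul_mul_smul_comm, x_mul_x h, smul_smul, smul_smul, mul_comm,
      mul_comm (l i : F)]

@[simp] theorem scale_x (l : Fin n → Fˣ) (i : Fin n) :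
    scale l (x F n q i) = (l i : F) • x F n q i := by simp [scale]

theorem scale_scale {l l' : Fin n → Fˣ} (h : ∀ i, l i * l' i = 1) (a : QuantumAffineSpace F n q) :
    scale l (scale l' a) = a := by
  have : (scale l).comp (scale l') = AlgHom.id F (QuantumAffineSpace F n q) := by
    refine algHom_ext fun i => ?_
    simp [smul_smul, ← Units.val_mul, mul_comm (l' i), h]
  exact DFunLike.congr_fun this a

theorem scale_mem_initial (l : Fin n → Fˣ) {k : ℕ} {a : QuantumAffineSpace F n q}
    (h : a ∈ initial F n q k) : scale l a ∈ initial F n q k := by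
  have : initial F n q k ≤ (initial F n q k).comap (scale l) := by
    refine Algebra.adjoin_le ?_
    rintro _ ⟨i, hi, rfl⟩
    change scale l (x F n q i) ∈ initial F n q k
    rw [scale_x]
    exact Subalgebra.smul_mem _ (x_mem_initial hi) _
  exact this h

/-- The restriction of a diagonal automorphism to the subalgebra of the first `k` generators. -/
noncomputable def scaleInitial (l : Fin n → Fˣ) (k : ℕ) :
    initial F n q k ≃ₐ[F] initial F n q k :=
  AlgEquiv.ofAlgHom
    (((scale l).comp (initial F n q k).val).codRestrict _ fun a => scale_mem_initial l a.2)
    (((scale l⁻¹).comp (initial F n q k).val).codRestrict _ fun a => scale_mem_initial _ a.2)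
    (by ext a; exact scale_scale (by simp) _)
    (by ext a; exact scale_scale (by simp) _)

@[simp] theorem coe_scaleInitial (l : Fin n → Fˣ) {k : ℕ} (a : initial F n q k) :
    (scaleInitial l k a : QuantumAffineSpace F n q) = scale l a := rfl

/-! ### Left polynomials -/

variable (q) in
/-- The scalars `qᵢ⁻¹` by which the twisting automorphisms multiply the generators. The last
generator has no `qᵢ`, and is never moved. -/
def twistScalar (i : Fin n) : Fˣ := if h : i.val < n - 1 then (q ⟨i.val, h⟩)⁻¹ else 1

theorem x_mul_of_mem_initial {k : ℕ} (hk : k < n) {r : QuantumAffineSpace F n q}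
    (hr : r ∈ initial F n q k) :
    x F n q ⟨k, hk⟩ * r = scale (twistScalar q) r * x F n q ⟨k, hk⟩ := by
  induction hr using Algebra.adjoin_induction with
  | mem a h =>
    obtain ⟨i, hi, rfl⟩ := h
    rw [scale_x, smul_mul_assoc, x_mul_x (j := ⟨k, hk⟩) hi, smul_smul, twistScalar,
      dif_pos (by omega), ← Units.val_mul, inv_mul_cancel, Units.val_one, one_smul]
  | algebraMap r => rw [AlgHom.commutes, Algebra.commutes]
  | add a b _ _ ha hb => rw [mul_add, map_add, add_mul, ha, hb]
  | mul a b _ _ ha hb => rw [← mul_assoc, ha, mul_assoc, hb, map_mul, mul_assoc]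

/-- The left polynomial `∑ rⱼ xₖ ^ j` with coefficients in the subalgebra of the preceding
generators. -/
noncomputable def leftPoly {k : ℕ} (hk : k < n) :
    (ℕ →₀ initial F n q k) →ₗ[F] QuantumAffineSpace F n q :=
  Finsupp.lsum F fun j =>
    LinearMap.mulRight F (x F n q ⟨k, hk⟩ ^ j) ∘ₗ (initial F n q k).val.toLinearMap

theorem leftPoly_apply {k : ℕ} (hk : k < n) (f : ℕ →₀ initial F n q k) :
    leftPoly hk f = f.sum fun j r => (r : QuantumAffineSpace F n q) * x F n q ⟨k, hk⟩ ^ j := rfl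

theorem leftPoly_single {k : ℕ} (hk : k < n) (j : ℕ) (r : initial F n q k) :
    leftPoly hk (Finsupp.single j r) = (r : QuantumAffineSpace F n q) * x F n q ⟨k, hk⟩ ^ j := by
  simp [leftPoly_apply]

/-- The left polynomials in `xₖ` are stable under left multiplication by the first generators,
so they fill the subalgebra that these generate. -/
theorem range_leftPoly {k : ℕ} (hk : k < n) :
    LinearMap.range (leftPoly (q := q) hk) = (initial F n q (k + 1)).toSubmodule := by
  apply le_antisymm
  · rintro _ ⟨f, rfl⟩
    rw [leftPoly_apply]
    exact Subalgebra.sum_mem _ fun j _ => Subalgebra.mul_mem _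
      (initial_mono F n q (Nat.le_succ k) (f j).2)
      (Subalgebra.pow_mem _ (x_mem_initial (Nat.lt_succ_self k)) j)
  · intro a ha
    suffices h : ∀ w ∈ LinearMap.range (leftPoly (q := q) hk),
        a * w ∈ LinearMap.range (leftPoly (q := q) hk) by
      have h1 : (1 : QuantumAffineSpace F n q) ∈ LinearMap.range (leftPoly (q := q) hk) :=
        ⟨Finsupp.single 0 1, by simp [leftPoly_single]⟩
      simpa using h 1 h1
    replace ha : a ∈ initial F n q (k + 1) := ha
    induction ha using Algebra.adjoin_induction with
    | mem a h =>
      obtain ⟨i, hi, rfl⟩ := h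
      rintro _ ⟨f, rfl⟩
      induction f using Finsupp.induction_linear with
      | zero => simp
      | add f g hf hg => rw [map_add, mul_add]; exact add_mem hf hg
      | single j r =>
        rw [leftPoly_single, ← mul_assoc]
        rcases Nat.lt_succ_iff_lt_or_eq.1 hi with h | h
        · refine ⟨Finsupp.single j (⟨_, x_mem_initial h⟩ * r), ?_⟩
          rw [leftPoly_single]; rfl
        · have hi' : i = ⟨k, hk⟩ := Fin.ext h
          refine ⟨Finsupp.single (j + 1) (scaleInitial (twistScalar q) k r), ?_⟩
          rw [leftPoly_single, hi', x_mul_of_mem_initial hk r.2, coe_scaleInitial, pow_succ',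
            mul_assoc]
    | algebraMap r =>
      intro w hw
      rw [← Algebra.smul_def]
      exact Submodule.smul_mem _ _ hw
    | add a b _ _ ha hb => intro w hw; rw [add_mul]; exact add_mem (ha w hw) (hb w hw)
    | mul a b _ _ ha hb => intro w hw; rw [mul_assoc]; exact ha _ (hb w hw)

/-! ### The embedding into the algebra of logarithmic forms -/

variable (q) in
/-- The matrix of the multiplication of monomials, with `1` above the diagonal so that the sorted
product `xᵢ xⱼ`, `i < j`, is a monomial. -/
def relMatrix (i j : Fin n) : Fˣ := if h : j < i then (q ⟨j.val, by omega⟩)⁻¹ else 1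

variable (q t) in
/-- The embedding of the quantum affine space as the span of the monomials of degree `0`. -/
noncomputable def toForms : QuantumAffineSpace F n q →ₐ[F] LogForms (relMatrix q) t :=
  liftHom (fun i => mono _ _ (Pi.single i 1, ∅)) fun i j h => by
    rw [mono_mul_mono, mono_mul_mono, smul_smul]
    simp only [structConst, twist, bichar_single, idxMul]
    simp [relMatrix, h, not_lt_of_gt h, add_comm]

@[simp] theorem toForms_x (i : Fin n) :
    toForms q t (x F n q i) = mono _ _ (Pi.single i 1, ∅) := by
  simp [toForms]

theorem toForms_x_pow (i : Fin n) (j : ℕ) :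
    toForms q t (x F n q i ^ j) = mono _ _ (Pi.single i j, ∅) := by
  induction j with
  | zero => simp [one_def]
  | succ j ih =>
    rw [pow_succ, map_mul, ih, toForms_x, mono_mul_mono]
    simp [structConst, twist, bichar_single, idxMul, relMatrix, ← Pi.single_add]

/-- The indices of the monomials in the first `k` generators. -/
def initialIdx (n k : ℕ) : Set (MonoIdx n) := {m | m.2 = ∅ ∧ ∀ i : Fin n, k ≤ i.val → m.1 i = 0}

theorem toForms_mem_initialIdx {k : ℕ} {r : QuantumAffineSpace F n q}
    (hr : r ∈ initial F n q k) : toForms q t r ∈ spanOn (relMatrix q) t (initialIdx n k) := by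
  have h1 : (1 : LogForms (relMatrix q) t) ∈ spanOn (relMatrix q) t (initialIdx n k) :=
    mono_mem_spanOn ⟨rfl, fun _ _ => rfl⟩
  induction hr using Algebra.adjoin_induction with
  | mem a h =>
    obtain ⟨i, hi, rfl⟩ := h
    rw [toForms_x]
    refine mono_mem_spanOn ⟨rfl, fun j hj => Pi.single_eq_of_ne ?_ _⟩
    rintro rfl
    omega
  | algebraMap r =>
    rw [AlgHom.commutes, Algebra.algebraMap_eq_smul_one]
    exact Submodule.smul_mem _ _ h1
  | add a b _ _ ha hb => rw [map_add]; exact add_mem ha hb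
  | mul a b _ _ ha hb =>
    rw [map_mul]
    refine mul_mem_spanOn ?_ ha hb
    rintro m ⟨h2, h3⟩ m' ⟨h2', h3'⟩ -
    exact ⟨by simp [idxMul, h2, h2'], fun i hi => by simp [idxMul, h3 i hi, h3' i hi]⟩

variable (t) in
/-- The coefficient of `x ^ a xₖ ^ j` in a left polynomial in `xₖ` comes from one of its
coefficients only. -/
theorem coeff_toForms_leftPoly {k : ℕ} (hk : k < n) (f : ℕ →₀ initial F n q k) (j : ℕ)
    {m : MonoIdx n} (hm : m ∈ initialIdx n k) :
    coeff (toForms q t (leftPoly hk f)) (idxMul m (Pi.single ⟨k, hk⟩ j, ∅)) =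
      structConst (relMatrix q) t m (Pi.single ⟨k, hk⟩ j, ∅) * coeff (toForms q t (f j)) m := by
  induction f using Finsupp.induction_linear with
  | zero => simp
  | add f g hf hg => simp only [map_add, Finsupp.add_apply, hf, hg, Subalgebra.coe_add, mul_add]
  | single l r =>
    rw [leftPoly_single, map_mul, toForms_x_pow]
    have hmul : ∀ m' ∈ initialIdx n k,
        LinearMap.mulRight F (mono (relMatrix q) t (Pi.single ⟨k, hk⟩ l, ∅)) (mono _ _ m') =
          structConst (relMatrix q) t m' (Pi.single ⟨k, hk⟩ l, ∅) •
            mono _ _ (idxMul m' (Pi.single ⟨k, hk⟩ l, ∅)) := fun m' _ => by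
      rw [LinearMap.mulRight_apply, mono_mul_mono]
    have hr := toForms_mem_initialIdx (t := t) r.2
    by_cases hl : l = j
    · subst hl
      rw [Finsupp.single_eq_same, ← coeff_monomialMap hmul hr _ hm]
      · rfl
      · intro m' hm' _ h
        simp only [idxMul, Prod.mk.injEq, add_left_inj] at h
        exact Prod.ext h.1 (by rw [hm'.1, hm.1])
    · rw [Finsupp.single_apply, if_neg hl]
      simp only [ZeroMemClass.coe_zero, map_zero, Finsupp.zero_apply, mul_zero]
      by_contra hne
      have h1 := mem_spanOn_iff.1 (map_mem_of_mono
        (LinearMap.mulRight F (mono (relMatrix q) t (Pi.single ⟨k, hk⟩ l, ∅)))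
        (spanOn (relMatrix q) t {m | m.1 ⟨k, hk⟩ = l}) (fun m' hm' => by
          rw [hmul m' hm']
          refine Submodule.smul_mem _ _ (mono_mem_spanOn ?_)
          simp [idxMul, hm'.2 ⟨k, hk⟩ le_rfl]) hr) _ hne
      simp [idxMul, hm.2 ⟨k, hk⟩ le_rfl] at h1
      exact hl h1.symm

theorem eq_zero_of_toForms_leftPoly {k : ℕ} (hk : k < n)
    (ih : ∀ r ∈ initial F n q k, toForms q t r = 0 → r = 0) {f : ℕ →₀ initial F n q k}
    (hf : toForms q t (leftPoly hk f) = 0) : f = 0 := by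
  ext j
  refine ih _ (f j).2 (coeff.injective ?_)
  ext m
  by_contra hm
  rw [map_zero, Finsupp.zero_apply] at hm
  have hmk := mem_spanOn_iff.1 (toForms_mem_initialIdx (t := t) (f j).2) m hm
  have := coeff_toForms_leftPoly t hk f j hmk
  rw [hf, map_zero, Finsupp.zero_apply] at this
  exact mul_ne_zero (structConst_ne_zero_of_disjoint (by simp)) hm this.symm

theorem eq_zero_of_toForms_of_mem {k : ℕ} (hk : k ≤ n) {r : QuantumAffineSpace F n q}
    (hr : r ∈ initial F n q k) (h : toForms q t r = 0) : r = 0 := by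
  induction k generalizing r with
  | zero =>
    rw [initial_zero, Algebra.mem_bot] at hr
    obtain ⟨s, rfl⟩ := hr
    rw [AlgHom.commutes, Algebra.algebraMap_eq_smul_one, one_def] at h
    have := congrArg (fun f => coeff f (0, ∅)) h
    simp only [map_smul, coeff_mono, Finsupp.smul_apply, Finsupp.single_eq_same, map_zero,
      Finsupp.zero_apply, smul_eq_mul, mul_one] at this
    rw [this, map_zero]
  | succ k ih =>
    have hr' : r ∈ LinearMap.range (leftPoly (q := q) hk) := by rw [range_leftPoly]; exact hr
    obtain ⟨f, rfl⟩ := hr'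
    rw [eq_zero_of_toForms_leftPoly hk (fun r hr => ih (Nat.le_of_succ_le hk) hr) h, map_zero]

variable (q t) in
/-- The ordered monomials in the generators are linearly independent. The induction adds one
generator at a time: a left polynomial in `xₖ` is zero only if its coefficients are. -/
theorem toForms_injective : Function.Injective (toForms q t) :=
  (injective_iff_map_eq_zero _).2 fun r h =>
    eq_zero_of_toForms_of_mem le_rfl (by rw [initial_eq_top]; trivial) h

theorem leftPoly_injective {k : ℕ} (hk : k < n) : Function.Injective (leftPoly (q := q) hk) :=
  (injective_iff_map_eq_zero _).2 fun f h =>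
    eq_zero_of_toForms_leftPoly (t := 1) hk
      (fun r _ hr => toForms_injective q 1 (hr.trans (map_zero _).symm)) (by rw [h, map_zero])

theorem isSkewPolynomialRing {k : ℕ} (hk : k < n) :
    IsSkewPolynomialRing (initial F n q k) (scaleInitial (twistScalar q) k) (x F n q ⟨k, hk⟩)
      (initial F n q (k + 1)) :=
  ⟨fun r => x_mul_of_mem_initial hk r.2, leftPoly_injective hk,
    congrArg (fun W : Submodule F (QuantumAffineSpace F n q) =>
      (W : Set (QuantumAffineSpace F n q))) (range_leftPoly hk)⟩

/-- The powers of a generator are distinct monomials. -/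
theorem aeval_x_injective (i : Fin n) :
    Function.Injective (Polynomial.aeval (R := F) (x F n q i)) := by
  refine (injective_iff_map_eq_zero _).2 fun p hp => ?_
  ext j
  have := congrArg (fun a => coeff (toForms q 1 a) (Pi.single i j, ∅)) hp
  by_cases hj : j ≤ p.natDegree
  swap
  · exact Polynomial.coeff_eq_zero_of_natDegree_lt (not_le.1 hj)
  simpa [Polynomial.aeval_eq_sum_range, map_sum, -map_pow, toForms_x_pow, coeff_mono,
    Finsupp.single_apply, Prod.ext_iff, Finset.sum_ite_eq,
    hj] using this

/-- Words of length at most `m` in the generators reach all monomials of total degree at most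
`m`. -/
theorem mono_mem_map_wordSpan {m : ℕ} {a : Fin n → ℕ} (h : ∑ i, a i ≤ m) :
    mono (relMatrix q) t (a, ∅) ∈
      (wordSpan F (Submodule.span F (Set.range (x F n q))) m).map (toForms q t).toLinearMap := by
  induction m generalizing a with
  | zero =>
    have ha : a = 0 := by
      ext i
      exact Nat.le_zero.1 ((Finset.single_le_sum (fun j _ => Nat.zero_le (a j))
        (Finset.mem_univ i)).trans h)
    refine ⟨1, Submodule.one_le.1 le_rfl, ?_⟩
    rw [ha]
    exact map_one (toForms q t)
  | succ m ih =>
    by_cases ha : a = 0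
    · refine ⟨1, ?_, ?_⟩
      · have h1 : (1 : QuantumAffineSpace F n q) ∈
            1 ⊔ Submodule.span F (Set.range (x F n q)) :=
          Submodule.mem_sup_left (Submodule.one_le.1 le_rfl)
        simpa [wordSpan] using Submodule.pow_mem_pow _ h1 (m + 1)
      · rw [ha]
        exact map_one (toForms q t)
    · obtain ⟨i, hi⟩ := Function.ne_iff.1 ha
      have hb := sub_single_add_single hi
      set b := a - Pi.single i 1
      have hsum : ∑ j, b j + 1 = ∑ j, a j := by
        rw [← hb]
        simp [Finset.sum_add_distrib]
      obtain ⟨r, hr, hrb⟩ := ih (a := b) (by omega)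
      have hc : structConst (relMatrix q) t (b, ∅) (Pi.single i 1, ∅) ≠ 0 :=
        structConst_ne_zero_of_disjoint (by simp)
      refine ⟨(structConst (relMatrix q) t (b, ∅) (Pi.single i 1, ∅))⁻¹ • (r * x F n q i),
        Submodule.smul_mem _ _ ?_, ?_⟩
      · rw [wordSpan, pow_succ]
        exact Submodule.mul_mem_mul hr
          (Submodule.mem_sup_right (Submodule.subset_span ⟨i, rfl⟩))
      · have h1 : toForms q t r = mono (relMatrix q) t (b, ∅) := hrb
        rw [map_smul]
        change _ • toForms q t (r * x F n q i) = _
        rw [map_mul, h1, toForms_x, mono_mul_mono, smul_smul, inv_mul_cancel₀ hc, one_smul]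
        simp [idxMul, hb]

/-- The image of the quantum affine space is the span of all monomials of degree `0`. -/
theorem range_toForms :
    LinearMap.range (toForms q t).toLinearMap = spanOn (relMatrix q) t {m | m.2 = ∅} := by
  apply le_antisymm
  · rintro _ ⟨r, rfl⟩
    refine spanOn_mono (fun m hm => hm.1) (toForms_mem_initialIdx (k := n) ?_)
    rw [initial_eq_top]; trivial
  · refine Submodule.span_le.2 ?_
    rintro _ ⟨⟨a, S⟩, hS, rfl⟩
    obtain rfl : S = ∅ := hS
    exact LinearMap.map_le_range (mono_mem_map_wordSpan le_rfl)

end QuantumAffineSpace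

namespace LogForms

variable {F : Type u} [Field F] {n : ℕ} {Q : Fin n → Fin n → Fˣ} {t : Fˣ}

/-! ### The differential -/

/-- The sign automorphism, equal to `(-1) ^ k` in degree `k`. -/
noncomputable def gradeSign : LogForms Q t →ₗ[F] LogForms Q t :=
  lift fun m => (-1 : F) ^ m.2.card • mono Q t m

theorem gradeSign_mono (m : MonoIdx n) :
    gradeSign (mono Q t m) = (-1 : F) ^ m.2.card • mono Q t m := lift_mono _ m

theorem gradeSign_mul (f g : LogForms Q t) : gradeSign (f * g) = gradeSign f * gradeSign g := by
  induction f using induction with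
  | ha f f' h1 h2 => rw [add_mul, map_add, h1, h2, map_add, add_mul]
  | hs r f h1 => rw [smul_mul_assoc, map_smul, h1, map_smul, smul_mul_assoc]
  | hm m =>
  induction g using induction with
  | ha f f' h1 h2 => rw [mul_add, map_add, h1, h2, map_add, mul_add]
  | hs r f h1 => rw [mul_smul_comm, map_smul, h1, map_smul, mul_smul_comm]
  | hm m' =>
  rw [mono_mul_mono, map_smul, gradeSign_mono, gradeSign_mono, gradeSign_mono,
    smul_mul_smul_comm, mono_mul_mono, smul_smul, smul_smul]
  by_cases h : Disjoint m.2 m'.2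
  · congr 1
    simp only [idxMul, Finset.card_union_of_disjoint h, pow_add]
    ring
  · simp [structConst, h]

theorem gradeSign_gradeSign (f : LogForms Q t) : gradeSign (gradeSign f) = f := by
  induction f using induction with
  | ha f f' h1 h2 => rw [map_add, map_add, h1, h2]
  | hs r f h1 => rw [map_smul, map_smul, h1]
  | hm m =>
  rw [gradeSign_mono, map_smul, gradeSign_mono, smul_smul, ← pow_add, ← two_mul, pow_mul]
  simp

variable (Q t) in
/-- The form `θ₁ + ⋯ + θₙ`, whose graded commutator is the differential. -/
noncomputable def theta : LogForms Q t := ∑ i, mono Q t (0, {i})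

theorem gradeSign_theta : gradeSign (theta Q t) = -theta Q t := by
  simp [theta, gradeSign_mono]

theorem mono_zero_mul_mono_zero (i j : Fin n) : mono Q t (0, {i}) * mono Q t (0, {j}) =
    -(mono Q t (0, {j}) * mono Q t (0, {i})) := by
  by_cases h : i = j
  · subst h
    simp [mono_mul_mono, structConst]
  · rw [mono_mul_mono, mono_mul_mono, ← neg_smul]
    simp [structConst, twist, h, Ne.symm h, idxMul, Finset.union_comm, swapSign_comm h]

/-- The square of `θ` is zero in every characteristic: the terms `θᵢ θⱼ` and `θⱼ θᵢ` cancel, and the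
terms `θᵢ ^ 2` are zero. -/
theorem theta_mul_theta : theta Q t * theta Q t = 0 := by
  rw [theta, Finset.sum_mul_sum, ← Finset.sum_product']
  refine Finset.sum_involution (fun p _ => p.swap) (fun p _ => ?_) (fun p _ hp h => hp ?_)
    (fun p _ => by simp) (fun p _ => by simp)
  · rw [mono_zero_mul_mono_zero p.1]
    simp
  · have : p.2 = p.1 := congrArg Prod.fst h
    rw [this, mono_mul_mono]
    simp [structConst]

variable (Q t) in
/-- The differential, `f ↦ θ f - (-1) ^ |f| f θ`. -/
noncomputable def diff : LogForms Q t →ₗ[F] LogForms Q t :=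
  LinearMap.mulLeft F (theta Q t) - LinearMap.mulRight F (theta Q t) ∘ₗ gradeSign

theorem diff_apply (f : LogForms Q t) :
    diff Q t f = theta Q t * f - gradeSign f * theta Q t := rfl

theorem diff_mul (f g : LogForms Q t) :
    diff Q t (f * g) = diff Q t f * g + gradeSign f * diff Q t g := by
  simp only [diff_apply, gradeSign_mul, sub_mul, mul_sub, mul_assoc]
  abel

theorem diff_diff (f : LogForms Q t) : diff Q t (diff Q t f) = 0 := by
  simp only [diff_apply, map_sub, gradeSign_mul, gradeSign_gradeSign, gradeSign_theta,
    ← mul_assoc, theta_mul_theta, zero_mul]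
  simp [mul_assoc, theta_mul_theta]

/-- The differential is of Koszul type; its `i`-th weight `t ^ aᵢ - 1` is zero when `xᵢ` does not
occur. -/
theorem diff_mono (a : Fin n → ℕ) (S : Finset (Fin n)) :
    diff Q t (mono Q t (a, S)) = ∑ i, (if i ∈ S then 0 else
      ((t : F) ^ a i - 1) * ((∏ j ∈ S, swapSign i j : Fˣ) : F)) • mono Q t (a, insert i S) := by
  rw [diff_apply, gradeSign_mono, theta, Finset.sum_mul, Finset.mul_sum, ← Finset.sum_sub_distrib]
  refine Finset.sum_congr rfl fun i _ => ?_
  rw [smul_mul_assoc, mono_mul_mono, mono_mul_mono, smul_smul]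
  by_cases hi : i ∈ S
  · simp [structConst, hi]
  · have hsign : (-1 : F) ^ S.card * ((∏ j ∈ S, swapSign j i : Fˣ) : F) =
        ((∏ j ∈ S, swapSign i j : Fˣ) : F) := by
      rw [← Finset.prod_const, Units.coe_prod, Units.coe_prod, ← Finset.prod_mul_distrib]
      refine Finset.prod_congr rfl fun j hj => ?_
      rw [swapSign_comm (F := F) (i := i) (j := j) (by rintro rfl; exact hi hj)]
      simp
    simp only [structConst, twist, idxMul, Finset.disjoint_singleton_left,
      Finset.disjoint_singleton_right, hi, not_false_eq_true, if_true, if_false, bichar_zero_left,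
      bichar_zero_right, zero_add, add_zero, one_mul, Finset.prod_singleton, Pi.zero_apply,
      pow_zero, Finset.prod_const_one, Units.val_mul, Units.val_pow_eq_pow_val, hsign,
      ← Finset.insert_eq, Finset.union_comm S]
    rw [sub_mul, sub_smul, one_mul]

/-! ### The subalgebra of regular forms -/

/-- The indices `(a, S)` for which `x ^ a θ_S` has no pole, when `θᵢ` is read as `xᵢ⁻¹ d xᵢ`: `xᵢ`
occurs in `x ^ a` whenever `θᵢ` occurs in `θ_S`. -/
def formIdx (n : ℕ) : Set (MonoIdx n) := {m | ∀ i ∈ m.2, m.1 i ≠ 0}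

theorem idxMul_mem_formIdx {m m' : MonoIdx n} (h : m ∈ formIdx n) (h' : m' ∈ formIdx n) :
    idxMul m m' ∈ formIdx n := by
  intro i hi hz
  have hz' : m.1 i + m'.1 i = 0 := hz
  rcases Finset.mem_union.1 hi with hi | hi
  · exact h i hi (by omega)
  · exact h' i hi (by omega)

variable (Q t) in
/-- The algebra of regular forms, generated by the `xᵢ` and the `xᵢ θᵢ`. -/
noncomputable def forms : Subalgebra F (LogForms Q t) :=
  (spanOn Q t (formIdx n)).toSubalgebra (mono_mem_spanOn fun i hi => by simp at hi)
    fun _ _ => mul_mem_spanOn fun _ h _ h' _ => idxMul_mem_formIdx h h'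

variable (Q t) in
/-- A regular monomial. -/
noncomputable def formMono (m : MonoIdx n) (h : m ∈ formIdx n) : forms Q t :=
  ⟨mono Q t m, mono_mem_spanOn h⟩

theorem formMono_mul_formMono {m m' : MonoIdx n} (h : m ∈ formIdx n) (h' : m' ∈ formIdx n) :
    formMono Q t m h * formMono Q t m' h' =
      structConst Q t m m' • formMono Q t (idxMul m m') (idxMul_mem_formIdx h h') :=
  Subtype.ext (mono_mul_mono m m')

/-- The term of `d (x ^ a θ_S)` that contains a new `θᵢ` has coefficient zero if `aᵢ = 0`, so the
differential creates no poles. -/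
theorem diff_mem_forms {f : LogForms Q t} (hf : f ∈ forms Q t) : diff Q t f ∈ forms Q t := by
  refine map_mem_of_mono (diff Q t) (spanOn Q t (formIdx n)) (fun m hm => ?_) hf
  obtain ⟨a, S⟩ := m
  rw [diff_mono]
  refine Submodule.sum_mem _ fun i _ => ?_
  by_cases hi : a i = 0
  · simp [hi]
  · refine Submodule.smul_mem _ _ (mono_mem_spanOn fun j hj => ?_)
    rcases Finset.mem_insert.1 hj with rfl | hj
    · exact hi
    · exact hm j hj

variable (Q t) in
/-- The differential of the algebra of regular forms. -/
noncomputable def formDiff : forms Q t →ₗ[F] forms Q t :=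
  ((diff Q t) ∘ₗ (forms Q t).val.toLinearMap).codRestrict (forms Q t).toSubmodule
    fun f => diff_mem_forms f.2

@[simp] theorem coe_formDiff (f : forms Q t) :
    (formDiff Q t f : LogForms Q t) = diff Q t (f : LogForms Q t) := rfl

/-! ### The grading -/

/-- The indices of the monomials of degree `k`. -/
def degIdx (n k : ℕ) : Set (MonoIdx n) := {m | m.2.card = k}

variable (Q t) in
/-- The regular forms of degree `k`. -/
noncomputable def formDeg (k : ℕ) : Submodule F (forms Q t) :=
  (spanOn Q t (degIdx n k)).comap (forms Q t).val.toLinearMap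

theorem formMono_mem_formDeg {m : MonoIdx n} (h : m ∈ formIdx n) {k : ℕ} (hk : m.2.card = k) :
    formMono Q t m h ∈ formDeg Q t k := mono_mem_spanOn (Q := Q) (t := t) (s := degIdx n k) hk

theorem formDeg_le {k : ℕ} {W : Submodule F (forms Q t)}
    (h : ∀ (m : MonoIdx n) (hm : m ∈ formIdx n), m.2.card = k → formMono Q t m hm ∈ W) :
    formDeg Q t k ≤ W := by
  intro f hf
  have h1 : (f : LogForms Q t) ∈ W.map (forms Q t).val.toLinearMap := by
    refine map_mem_of_mono LinearMap.id _ (fun m hm => ?_) (mem_spanOn_inter f.2 hf)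
    exact ⟨_, h m hm.1 hm.2, rfl⟩
  obtain ⟨g, hg, hgf⟩ := h1
  rwa [← Subtype.ext (a1 := g) (a2 := f) hgf]

theorem gradeSign_of_mem {k : ℕ} {f : LogForms Q t} (hf : f ∈ spanOn Q t (degIdx n k)) :
    gradeSign f = (-1 : F) ^ k • f := by
  refine map_eq_of_mono (ψ := (-1 : F) ^ k • LinearMap.id) (fun m hm => ?_) hf
  have : m.2.card = k := hm
  rw [gradeSign_mono, this]
  rfl

theorem diff_mem_spanOn_degIdx {k : ℕ} {f : LogForms Q t} (hf : f ∈ spanOn Q t (degIdx n k)) :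
    diff Q t f ∈ spanOn Q t (degIdx n (k + 1)) := by
  refine map_mem_of_mono (diff Q t) _ (fun m hm => ?_) hf
  obtain ⟨a, S⟩ := m
  have hS : S.card = k := hm
  rw [diff_mono]
  refine Submodule.sum_mem _ fun i _ => ?_
  by_cases hi : i ∈ S
  · simp [hi]
  · refine Submodule.smul_mem _ _ (mono_mem_spanOn ?_)
    change (insert i S).card = k + 1
    rw [Finset.card_insert_of_notMem hi, hS]

/-- The projection to the forms of degree `k`. -/
noncomputable def proj (k : ℕ) : LogForms Q t →ₗ[F] LogForms Q t :=
  lift fun m => if m.2.card = k then mono Q t m else 0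

theorem proj_mem {s : Set (MonoIdx n)} {f : LogForms Q t} (hf : f ∈ spanOn Q t s) (k : ℕ) :
    proj k f ∈ spanOn Q t (s ∩ degIdx n k) := by
  refine map_mem_of_mono (proj k) _ (fun m hm => ?_) hf
  rw [proj, lift_mono]
  split_ifs with h
  · exact mono_mem_spanOn ⟨hm, h⟩
  · exact zero_mem _

theorem proj_of_mem {k : ℕ} {f : LogForms Q t} (hf : f ∈ spanOn Q t (degIdx n k)) (l : ℕ) :
    proj l f = if l = k then f else 0 := by
  have h : proj l f = (if l = k then LinearMap.id else 0 : LogForms Q t →ₗ[F] LogForms Q t) f := by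
    refine map_eq_of_mono (fun m hm => ?_) hf
    have hm' : m.2.card = k := hm
    rw [proj, lift_mono, hm']
    by_cases hl : l = k
    · simp [hl]
    · simp [hl, Ne.symm hl]
  rw [h]
  split_ifs <;> rfl

theorem sum_proj (f : LogForms Q t) : ∑ k ∈ Finset.range (n + 1), proj k f = f := by
  have : ∑ k ∈ Finset.range (n + 1), proj k = (LinearMap.id : LogForms Q t →ₗ[F] LogForms Q t) := by
    refine ext_mono fun m => ?_
    have hm : m.2.card < n + 1 := Nat.lt_succ_of_le (card_finset_fin_le m.2)
    simp [LinearMap.sum_apply, proj, hm]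
  simpa [LinearMap.sum_apply] using LinearMap.congr_fun this f

/-- The component of degree `k` of a regular form. -/
noncomputable def formProj (k : ℕ) : forms Q t →ₗ[F] formDeg Q t k where
  toFun f := ⟨⟨proj k f, spanOn_mono Set.inter_subset_left (proj_mem f.2 k)⟩,
    spanOn_mono Set.inter_subset_right (proj_mem f.2 k)⟩
  map_add' _ _ := Subtype.ext (Subtype.ext (map_add (proj k) _ _))
  map_smul' _ _ := Subtype.ext (Subtype.ext (map_smul (proj k) _ _))

noncomputable instance formDecomposition : DirectSum.Decomposition (formDeg Q t) where
  decompose' f := ∑ k ∈ Finset.range (n + 1), DirectSum.of (fun k => formDeg Q t k) k (formProj k f)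
  left_inv f := by
    rw [map_sum]
    simp only [DirectSum.coeAddMonoidHom_of]
    apply Subtype.ext
    rw [AddSubmonoidClass.coe_finsetSum]
    exact sum_proj (f : LogForms Q t)
  right_inv x := by
    induction x using DirectSum.induction_on with
    | zero => simp
    | add x y hx hy =>
      rw [map_add]
      simp only [map_add, Finset.sum_add_distrib]
      exact congrArg₂ (· + ·) hx hy
    | of k f =>
      have key : ∀ l, DirectSum.of (fun k => formDeg Q t k) l (formProj l (f : forms Q t)) =
          if l = k then DirectSum.of (fun k => formDeg Q t k) k f else 0 := by
        intro l
        have h := proj_of_mem f.2 l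
        by_cases hl : l = k
        · subst hl
          rw [if_pos rfl] at h ⊢
          congr 1
          exact Subtype.ext (Subtype.ext h)
        · rw [if_neg hl] at h ⊢
          rw [show formProj l (f : forms Q t) = 0 from Subtype.ext (Subtype.ext h), map_zero]
      simp only [DirectSum.coeAddMonoidHom_of, key]
      by_cases hk : k < n + 1
      · simp [hk]
      · rw [Finset.sum_ite_eq' , if_neg (by simpa using hk)]
        have hf : f = 0 := by
          have hle : formDeg Q t k ≤ ⊥ := formDeg_le fun m _ hm => by
            have := card_finset_fin_le m.2
            omega
          exact Subtype.ext (hle f.2)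
        rw [hf, map_zero]

noncomputable instance formGradedAlgebra : GradedAlgebra (formDeg Q t) :=
  { formDecomposition with
    one_mem := formMono_mem_formDeg (m := (0, ∅)) (fun i hi => by simp at hi) rfl
    mul_mem := fun {k l} f g hf hg => by
      refine mul_mem_spanOn (s := degIdx n k) (s' := degIdx n l) ?_ hf hg
      intro m hm m' hm' hd
      have h1 : m.2.card = k := hm
      have h2 : m'.2.card = l := hm'
      change (m.2 ∪ m'.2).card = k + l
      rw [Finset.card_union_of_disjoint hd, h1, h2] }

theorem formDeg_eq_bot {k : ℕ} (hk : n < k) : formDeg Q t k = ⊥ :=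
  eq_bot_iff.2 <| formDeg_le fun m _ hm => by
    have := card_finset_fin_le m.2
    omega

/-! ### The density condition -/

theorem single_mem_formIdx (i : Fin n) : ((Pi.single i 1, ∅) : MonoIdx n) ∈ formIdx n :=
  fun j hj => by simp at hj

theorem single_singleton_mem_formIdx (i : Fin n) :
    ((Pi.single i 1, {i}) : MonoIdx n) ∈ formIdx n := by
  intro j hj
  obtain rfl := Finset.mem_singleton.1 hj
  simp

/-- `d xᵢ = (t - 1) xᵢ θᵢ`. -/
theorem formDiff_single (i : Fin n) :
    formDiff Q t (formMono Q t _ (single_mem_formIdx i)) =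
      ((t : F) - 1) • formMono Q t _ (single_singleton_mem_formIdx i) := by
  apply Subtype.ext
  change diff Q t (mono Q t (Pi.single i 1, ∅)) = ((t : F) - 1) • mono Q t (Pi.single i 1, {i})
  rw [diff_mono, Finset.sum_eq_single i]
  · simp
  · intro j _ hj
    simp [Pi.single_eq_of_ne hj]
  · simp

/-- A regular monomial of degree `k` is, up to a scalar, an element of the quantum affine space
times a product of `k` differentials `d xᵢ`; this needs `t - 1` to be invertible. -/
theorem formMono_mem_mul_pow (ht : t ≠ 1) {k : ℕ} {a : Fin n → ℕ} {S : Finset (Fin n)}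
    (h : (a, S) ∈ formIdx n) (hS : S.card = k) :
    formMono Q t (a, S) h ∈ formDeg Q t 0 * (formDeg Q t 0).map (formDiff Q t) ^ k := by
  induction k generalizing a S with
  | zero =>
    rw [pow_zero, mul_one]
    exact formMono_mem_formDeg h hS
  | succ k ih =>
    obtain ⟨i, hi⟩ : S.Nonempty := Finset.card_pos.1 (by omega)
    have hS' : (S.erase i).card = k := by rw [Finset.card_erase_of_mem hi, hS]; rfl
    have hb : ((a - Pi.single i 1, S.erase i) : MonoIdx n) ∈ formIdx n := by
      intro j hj
      have hne := (Finset.mem_erase.1 hj).1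
      simpa [Pi.single_eq_of_ne hne] using h j (Finset.mem_erase.1 hj).2
    have hc : structConst Q t (a - Pi.single i 1, S.erase i) (Pi.single i 1, {i}) ≠ 0 :=
      structConst_ne_zero_of_disjoint (by simp)
    have ht' : (t : F) - 1 ≠ 0 := sub_ne_zero.2 fun h => ht (Units.ext h)
    have hdx : formMono Q t _ (single_singleton_mem_formIdx i) ∈
        (formDeg Q t 0).map (formDiff Q t) := by
      refine ⟨((t : F) - 1)⁻¹ • formMono Q t _ (single_mem_formIdx i),
        Submodule.smul_mem _ _ (formMono_mem_formDeg _ rfl), ?_⟩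
      rw [map_smul, formDiff_single, smul_smul, inv_mul_cancel₀ ht', one_smul]
    have hmul := Submodule.mul_mem_mul (ih hb hS') hdx
    rw [mul_assoc, ← pow_succ, formMono_mul_formMono] at hmul
    have hidx : idxMul (a - Pi.single i 1, S.erase i) (Pi.single i 1, {i}) = (a, S) := by
      refine Prod.ext ?_ ?_
      · exact sub_single_add_single (h i hi)
      · change S.erase i ∪ {i} = S
        rw [Finset.union_comm, ← Finset.insert_eq, Finset.insert_erase hi]
    simp only [hidx] at hmul
    exact (Submodule.smul_mem_iff _ hc).1 hmul

theorem formDeg_eq_mul_pow (ht : t ≠ 1) (k : ℕ) :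
    formDeg Q t k = formDeg Q t 0 * (formDeg Q t 0).map (formDiff Q t) ^ k := by
  refine le_antisymm (formDeg_le fun m hm hk => formMono_mem_mul_pow ht hm hk) ?_
  have hd : (formDeg Q t 0).map (formDiff Q t) ≤ formDeg Q t 1 := by
    rintro _ ⟨f, hf, rfl⟩
    exact diff_mem_spanOn_degIdx hf
  have hpow : (formDeg Q t 0).map (formDiff Q t) ^ k ≤ formDeg Q t k := by
    induction k with
    | zero => exact Submodule.one_le.2 (SetLike.GradedOne.one_mem (A := formDeg Q t))
    | succ k ih =>
      rw [pow_succ]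
      exact Submodule.mul_le.2 fun f hf g hg => SetLike.mul_mem_graded (ih hf) (hd hg)
  refine Submodule.mul_le.2 fun f hf g hg => ?_
  have := SetLike.mul_mem_graded hf (hpow hg)
  rwa [zero_add] at this

end LogForms

/-! ### The coordinate of a top form -/

namespace DifferentialCalculus

variable {F : Type u} [Field F] {R : Type v} [Ring R] [Algebra F R]
  {Ω : Type v} [Ring Ω] [Algebra F Ω] {C : DifferentialCalculus F R Ω}

theorem mul_ι_coord {N : ℕ} {v : C.deg N} (hv : C.IsVolumeForm v) (γ : C.deg N) :
    (v : Ω) * C.ι (coord hv γ) = γ :=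
  congrArg Subtype.val ((LinearEquiv.ofBijective (C.rightGen v) hv.1).apply_symm_apply γ)

theorem mul_ι_ell {N : ℕ} {v : C.deg N} (hv : C.IsVolumeForm v) {k : ℕ} (hk : k ≤ N)
    (γ : C.deg k) (γ' : C.deg (N - k)) :
    (v : Ω) * C.ι ((ell hv k hk γ).1 γ') = (γ : Ω) * (γ' : Ω) :=
  mul_ι_coord hv _

end DifferentialCalculus

namespace QuantumAffineSpace

open LogForms DifferentialCalculus

variable {F : Type u} [Field F] {n : ℕ} {q : Fin (n - 1) → Fˣ} {t : Fˣ}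

/-! ### The calculus of regular forms -/

theorem toForms_mem_spanOn (r : QuantumAffineSpace F n q) :
    toForms q t r ∈ spanOn (relMatrix q) t {m | m.2 = ∅} := by
  rw [← range_toForms]
  exact ⟨r, rfl⟩

theorem mem_formIdx_of_eq_empty {m : MonoIdx n} (h : m.2 = ∅) : m ∈ formIdx n := fun i hi => by
  simp [h] at hi

theorem toForms_mem_forms (r : QuantumAffineSpace F n q) :
    toForms q t r ∈ forms (relMatrix q) t :=
  spanOn_mono (fun _ => mem_formIdx_of_eq_empty) (toForms_mem_spanOn r)

variable (q) in
/-- The differential calculus of regular forms on the quantum affine space. -/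
noncomputable def calculus (t : Fˣ) (ht : t ≠ 1) :
    DifferentialCalculus F (QuantumAffineSpace F n q) (forms (relMatrix q) t) where
  deg := formDeg (relMatrix q) t
  graded := formGradedAlgebra
  ι := (toForms q t).codRestrict _ toForms_mem_forms
  ι_injective r s h := toForms_injective q t (congrArg Subtype.val h)
  range_ι := by
    apply le_antisymm
    · rintro _ ⟨r, rfl⟩
      exact spanOn_mono (s' := degIdx n 0) (fun m hm => Finset.card_eq_zero.2 hm)
        (toForms_mem_spanOn r)
    · intro f hf
      have h : (f : LogForms (relMatrix q) t) ∈ LinearMap.range (toForms q t).toLinearMap := by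
        rw [range_toForms]
        exact spanOn_mono (s := degIdx n 0) (fun m hm => Finset.card_eq_zero.1 hm) hf
      obtain ⟨r, hr⟩ := h
      exact ⟨r, Subtype.ext hr⟩
  d := formDiff (relMatrix q) t
  d_mem _ _ h := diff_mem_spanOn_degIdx h
  d_d ω := Subtype.ext (diff_diff _)
  leibniz k ω hω η := by
    apply Subtype.ext
    have h := diff_mul (ω : LogForms (relMatrix q) t) η
    have hsign : gradeSign (ω : LogForms (relMatrix q) t) = (-1 : F) ^ k • (ω : LogForms _ t) :=
      gradeSign_of_mem hω
    rw [hsign] at h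
    simpa [Algebra.smul_def, mul_assoc] using h
  density := formDeg_eq_mul_pow ht

@[simp] theorem coe_calculus_ι (ht : t ≠ 1) (r : QuantumAffineSpace F n q) :
    ((calculus q t ht).ι r : LogForms (relMatrix q) t) = toForms q t r := rfl

/-- In `d x ^ a = ∑ (t ^ aᵢ - 1) x ^ a θᵢ` some coefficient is nonzero unless `a = 0`, because `t`
is not a root of unity. -/
theorem isConnected_calculus (ht : t ≠ 1) (ht' : ∀ m : ℕ, 0 < m → t ^ m ≠ 1) :
    (calculus q t ht).IsConnected := by
  apply le_antisymm
  · intro r hr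
    have hr' : diff (relMatrix q) t (toForms q t r) = 0 := congrArg Subtype.val hr
    have hcoeff : ∀ a : Fin n → ℕ, a ≠ 0 → coeff (toForms q t r) (a, ∅) = 0 := by
      intro a ha
      obtain ⟨i, hi⟩ := Function.ne_iff.1 ha
      have h : coeff (diff (relMatrix q) t (toForms q t r)) (a, {i}) =
          ((t : F) ^ a i - 1) * coeff (toForms q t r) (a, ∅) := by
        refine map_eq_of_mono
          (φ := Finsupp.lapply (a, {i}) ∘ₗ coeff.toLinearMap ∘ₗ diff (relMatrix q) t)
          (ψ := ((t : F) ^ a i - 1) • (Finsupp.lapply (a, ∅) ∘ₗ coeff.toLinearMap))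
          (fun m hm => ?_) (toForms_mem_spanOn r)
        obtain ⟨b, S⟩ := m
        obtain rfl : S = ∅ := hm
        simp only [LinearMap.comp_apply, diff_mono, map_sum, map_smul, LinearEquiv.coe_coe,
          coeff_mono, Finsupp.lapply_apply, LinearMap.smul_apply, smul_eq_mul]
        rw [Finset.sum_eq_single i]
        · by_cases hb : b = a
          · subst hb; simp
          · simp [hb]
        · intro j _ hj
          simp [hj]
        · simp
      rw [hr', map_zero, Finsupp.zero_apply] at h
      refine (mul_eq_zero.1 h.symm).resolve_left fun h0 => ht' (a i) (Nat.pos_of_ne_zero hi) ?_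
      exact Units.ext (by simpa using sub_eq_zero.1 h0)
    refine ⟨coeff (toForms q t r) (0, ∅), toForms_injective q t (coeff.injective ?_)⟩
    ext ⟨a, S⟩
    rw [Algebra.linearMap_apply, AlgHom.commutes, Algebra.algebraMap_eq_smul_one, one_def,
      map_smul, coeff_mono]
    by_cases hS : S = ∅
    · subst hS
      by_cases ha : a = 0
      · subst ha; simp
      · rw [hcoeff a ha]
        simp [Ne.symm ha]
    · have h1 : coeff (toForms q t r) (a, S) = 0 := by
        by_contra h
        exact hS (mem_spanOn_iff.1 (toForms_mem_spanOn r) _ h)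
      rw [h1]
      simp [Ne.symm hS]
  · rintro _ ⟨s, rfl⟩
    apply Subtype.ext
    change diff (relMatrix q) t (toForms q t (algebraMap F _ s)) = 0
    rw [AlgHom.commutes, Algebra.algebraMap_eq_smul_one, one_def, map_smul, diff_mono]
    simp

/-! ### The volume form -/

/-- The exponents of the product of the `xᵢ` with `i` in `T`. -/
def indicator (T : Finset (Fin n)) : Fin n → ℕ := fun i => if i ∈ T then 1 else 0

theorem indicator_mem_formIdx (T : Finset (Fin n)) : (indicator T, T) ∈ formIdx n := fun i hi => by
  simpa [indicator] using hi

theorem sub_indicator_add_indicator {a : Fin n → ℕ} {T : Finset (Fin n)}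
    (h : (a, T) ∈ formIdx n) : a - indicator T + indicator T = a := by
  ext i
  by_cases hi : i ∈ T
  · have : a i ≠ 0 := h i hi
    simp only [Pi.add_apply, Pi.sub_apply, indicator, hi, if_true]
    omega
  · simp [indicator, hi]

/-- The form `x_T θ_T`. These forms, with `T` of size `k`, are a basis of the right module of
forms of degree `k`. -/
noncomputable def basicForm (ht : t ≠ 1) {k : ℕ} (T : Finset (Fin n)) (hT : T.card = k) :
    (calculus q t ht).deg k :=
  ⟨formMono _ _ _ (indicator_mem_formIdx T), formMono_mem_formDeg _ hT⟩

theorem coe_basicForm (ht : t ≠ 1) {k : ℕ} (T : Finset (Fin n)) (hT : T.card = k) :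
    ((basicForm (q := q) ht T hT : forms (relMatrix q) t) : LogForms (relMatrix q) t) =
      mono (relMatrix q) t (indicator T, T) := rfl

variable (n) in
theorem idxMul_left_injective (m : MonoIdx n) : Set.InjOn (idxMul m) {m | m.2 = ∅} :=
  fun m' hm m'' hm' h => by
    simp only [idxMul, Prod.mk.injEq, add_right_inj] at h
    exact Prod.ext h.1 (hm.trans hm'.symm)

theorem top_eq_image_idxMul_left {m : MonoIdx n} (h : m ∈ formIdx n ∩ degIdx n n) :
    m ∈ idxMul (indicator Finset.univ, Finset.univ) '' {m | m.2 = ∅} := by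
  have hm : m.2 = Finset.univ := (Finset.card_eq_iff_eq_univ _).1
    ((show m.2.card = n from h.2).trans (by simp))
  refine ⟨(m.1 - indicator Finset.univ, ∅), rfl, ?_⟩
  refine Prod.ext ?_ (by simp [idxMul, hm])
  have := sub_indicator_add_indicator (T := Finset.univ) (a := m.1) (by rw [← hm]; exact h.1)
  rw [add_comm] at this
  exact this

theorem idxMul_comm (m m' : MonoIdx n) : idxMul m m' = idxMul m' m := by
  simp [idxMul, add_comm, Finset.union_comm]

/-- The form `x₁ ⋯ xₙ θ₁ ⋯ θₙ` is a volume form. -/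
theorem isVolumeForm (ht : t ≠ 1) :
    (calculus q t ht).IsVolumeForm (basicForm (q := q) ht Finset.univ (Finset.card_fin n)) := by
  set V : MonoIdx n := (indicator Finset.univ, Finset.univ) with hV
  -- both multiplications are monomial maps with the same effect on the indices
  have key : ∀ (φ : LogForms (relMatrix q) t →ₗ[F] LogForms (relMatrix q) t) (w : MonoIdx n → F)
      (_ : ∀ m, m.2 = ∅ → w m ≠ 0)
      (_ : ∀ m, φ (mono _ _ m) = w m • mono _ _ (idxMul V m))
      (ψ : QuantumAffineSpace F n q →ₗ[F] (calculus q t ht).deg n)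
      (_ : ∀ r, ((ψ r : forms (relMatrix q) t) : LogForms (relMatrix q) t) = φ (toForms q t r)),
      Function.Bijective ψ := by
    intro φ w hw hφ ψ hψ
    constructor
    · refine (injective_iff_map_eq_zero ψ).2 fun r hr => ?_
      apply toForms_injective q t
      rw [map_zero]
      refine eq_zero_of_monomialMap (φ := φ) (fun m _ => hφ m) hw (idxMul_left_injective n V)
        (toForms_mem_spanOn r) ?_
      rw [← hψ, hr]
      rfl
    · intro f
      have hf : ((f : forms (relMatrix q) t) : LogForms (relMatrix q) t) ∈
          spanOn (relMatrix q) t (idxMul V '' {m | m.2 = ∅}) :=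
        spanOn_mono (fun m hm => top_eq_image_idxMul_left hm) (mem_spanOn_inter f.1.2 f.2)
      obtain ⟨g, hg, hgf⟩ := exists_preimage_monomialMap (φ := φ) (fun m _ => hφ m) hw hf
      obtain ⟨r, rfl⟩ : g ∈ LinearMap.range (toForms q t).toLinearMap := by
        rw [range_toForms]
        exact hg
      exact ⟨r, Subtype.ext (Subtype.ext ((hψ r).trans hgf))⟩
  constructor
  · refine key (LinearMap.mulLeft F (mono _ _ V)) (structConst (relMatrix q) t V) (fun m hm => ?_)
      (fun m => mono_mul_mono V m) _ fun r => rfl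
    exact structConst_ne_zero_of_disjoint (by simp [hm])
  · refine key (LinearMap.mulRight F (mono _ _ V)) (fun m => structConst (relMatrix q) t m V)
      (fun m hm => ?_) (fun m => ?_) _ fun r => rfl
    · exact structConst_ne_zero_of_disjoint (by simp [hm])
    · rw [idxMul_comm]
      exact mono_mul_mono m V

theorem hasDimension_calculus (ht : t ≠ 1) : (calculus q t ht).HasDimension n := by
  refine ⟨fun h => ?_, fun k hk => formDeg_eq_bot hk⟩
  have h1 := (basicForm (q := q) ht Finset.univ (Finset.card_fin n)).2
  have h2 := congrArg (fun f : forms (relMatrix q) t =>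
    coeff (f : LogForms (relMatrix q) t) (indicator Finset.univ, Finset.univ))
    ((Submodule.mem_bot F).1 (h.le h1))
  simp [coe_basicForm, coeff_mono] at h2

/-! ### Integrability -/

/-- A right linear map is determined by its values on the forms `x_T θ_T`. -/
theorem rightHom_ext (ht : t ≠ 1) {k : ℕ} {φ ψ : (calculus q t ht).RightHom k}
    (h : ∀ (T : Finset (Fin n)) (hT : T.card = k),
      φ.1 (basicForm ht T hT) = ψ.1 (basicForm ht T hT)) : φ = ψ := by
  apply Subtype.ext
  have hle : formDeg (relMatrix q) t k ≤
      (LinearMap.eqLocus φ.1 ψ.1).map ((calculus q t ht).deg k).subtype := by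
    refine formDeg_le ?_
    rintro ⟨a, T⟩ hm hT
    have hc : structConst (relMatrix q) t (indicator T, T) (a - indicator T, ∅) ≠ 0 :=
      structConst_ne_zero_of_disjoint (by simp)
    obtain ⟨r, hr⟩ : mono (relMatrix q) t (a - indicator T, ∅) ∈
        LinearMap.range (toForms q t).toLinearMap := by
      rw [range_toForms]
      exact mono_mem_spanOn rfl
    have hr' : toForms q t r = mono (relMatrix q) t (a - indicator T, ∅) := hr
    refine ⟨(structConst (relMatrix q) t (indicator T, T) (a - indicator T, ∅))⁻¹ •
      (calculus q t ht).rightAct (basicForm ht T hT) r, ?_, ?_⟩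
    · change φ.1 _ = ψ.1 _
      rw [map_smul, map_smul, φ.2, ψ.2, h]
    · apply Subtype.ext
      change _ • (mono (relMatrix q) t (indicator T, T) * toForms q t r) =
        mono (relMatrix q) t (a, T)
      rw [hr', mono_mul_mono, smul_smul, inv_mul_cancel₀ hc, one_smul, idxMul_comm, idxMul,
        sub_indicator_add_indicator hm, Finset.empty_union]
  ext γ
  obtain ⟨γ', h1, h2⟩ := hle γ.2
  rw [← Subtype.ext (a1 := γ') (a2 := γ) h2]
  exact h1

/-- Multiplication by `x_T θ_T`, with `T` of complementary size, detects the part of a form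
on the monomials `x ^ a θ_S` with `S` the complement of `T`. -/
theorem ell_injective (ht : t ≠ 1) {k : ℕ} (hk : k ≤ n) :
    Function.Injective (ell (isVolumeForm (q := q) ht) k hk) := by
  refine (injective_iff_map_eq_zero _).2 fun γ hγ => ?_
  have hzero : ∀ (T : Finset (Fin n)) (_ : T.card = n - k),
      ((γ : forms (relMatrix q) t) : LogForms (relMatrix q) t) *
        mono (relMatrix q) t (indicator T, T) = 0 := by
    intro T hT
    have h := mul_ι_ell (isVolumeForm (q := q) ht) hk γ (basicForm ht T hT)
    rw [hγ] at h
    have h2 := congrArg (Subtype.val) h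
    simpa [coe_basicForm] using h2.symm
  apply Subtype.ext
  apply Subtype.ext
  apply coeff.injective
  ext ⟨a, S⟩
  by_contra hne
  have hS : S.card = k := mem_spanOn_iff.1 γ.2 (a, S) (fun h => hne (by simpa using h))
  have hT : Sᶜ.card = n - k := by rw [Finset.card_compl, Fintype.card_fin, hS]
  have h := coeff_monomialMap
    (φ := LinearMap.mulRight F (mono (relMatrix q) t (indicator Sᶜ, Sᶜ)))
    (g := fun m => idxMul m (indicator Sᶜ, Sᶜ))
    (w := fun m => structConst (relMatrix q) t m (indicator Sᶜ, Sᶜ))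
    (s := degIdx n k) (m := (a, S))
    (fun m _ => mono_mul_mono m _) γ.2 (fun m hm hw heq => ?_) hS
  · have h0 := hzero Sᶜ hT
    rw [LinearMap.mulRight_apply] at h
    change coeff (((γ : forms (relMatrix q) t) : LogForms (relMatrix q) t) *
      mono (relMatrix q) t (indicator Sᶜ, Sᶜ)) _ = _ at h
    rw [h0, map_zero, Finsupp.zero_apply] at h
    refine mul_ne_zero (structConst_ne_zero_of_disjoint ?_) (fun h => hne (by simpa using h)) h.symm
    exact disjoint_compl_right
  · simp only [idxMul, Prod.mk.injEq, add_left_inj] at heq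
    have hd : Disjoint m.2 Sᶜ := by
      by_contra hd
      exact hw (by simp [structConst, hd])
    have hm' : m.2.card = k := hm
    refine Prod.ext heq.1 (Finset.eq_of_subset_of_card_le ?_ (by simp [hS, hm']))
    exact (disjoint_compl_right_iff).1 hd

/-- For `φ` right linear, a preimage is the sum, over the `T` of size `n - k`, of a form on the
complement of `T` whose product with `x_T θ_T` is the volume form times `φ (x_T θ_T)`. -/
theorem ell_surjective (ht : t ≠ 1) {k : ℕ} (hk : k ≤ n) :
    Function.Surjective (ell (isVolumeForm (q := q) ht) k hk) := by
  intro φ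
  set V : MonoIdx n := (indicator Finset.univ, Finset.univ) with hV
  let r : Finset (Fin n) → QuantumAffineSpace F n q := fun T =>
    if hT : T.card = n - k then φ.1 (basicForm ht T hT) else 0
  have hex : ∀ T : Finset (Fin n), ∃ f ∈ spanOn (relMatrix q) t (formIdx n ∩ {m | m.2 = Tᶜ}),
      f * mono (relMatrix q) t (indicator T, T) = mono _ _ V * toForms q t (r T) := by
    intro T
    refine exists_preimage_monomialMap
      (φ := LinearMap.mulRight F (mono (relMatrix q) t (indicator T, T)))
      (g := fun m => idxMul m (indicator T, T))
      (w := fun m => structConst (relMatrix q) t m (indicator T, T))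
      (fun m _ => mono_mul_mono m _) (fun m hm => ?_) ?_
    · refine structConst_ne_zero_of_disjoint ?_
      rw [hm.2]
      exact disjoint_compl_left
    · have h1 : mono (relMatrix q) t V * toForms q t (r T) ∈
          spanOn (relMatrix q) t (formIdx n ∩ {m | m.2 = Finset.univ}) := by
        refine mul_mem_spanOn ?_ (mono_mem_spanOn (Set.mem_singleton V))
          (toForms_mem_spanOn (r T))
        rintro _ rfl m hm -
        exact ⟨idxMul_mem_formIdx (indicator_mem_formIdx _) (mem_formIdx_of_eq_empty hm),
          by simp [idxMul, hV]⟩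
      refine spanOn_mono ?_ h1
      rintro ⟨a, S⟩ ⟨ha, rfl⟩
      refine ⟨(a - indicator T, Tᶜ), ⟨fun i hi => ?_, rfl⟩, ?_⟩
      · have hi' : i ∉ T := by simpa using hi
        simpa [indicator, hi'] using ha i (Finset.mem_univ i)
      · refine Prod.ext ?_ ?_
        · exact sub_indicator_add_indicator fun i _ => ha i (Finset.mem_univ i)
        · change Tᶜ ∪ T = Finset.univ
          rw [Finset.union_comm, Finset.union_compl]
  choose γ hγ hγV using hex
  let Γ : LogForms (relMatrix q) t := ∑ T ∈ Finset.powersetCard (n - k) Finset.univ, γ T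
  have hΓ1 : Γ ∈ forms (relMatrix q) t := Subalgebra.sum_mem _ fun T _ =>
    spanOn_mono Set.inter_subset_left (hγ T)
  have hΓ2 : Γ ∈ spanOn (relMatrix q) t (degIdx n k) := Submodule.sum_mem _ fun T hT =>
    spanOn_mono (fun m hm => by
      have hm2 : m.2 = Tᶜ := hm.2
      have hT' := (Finset.mem_powersetCard.1 hT).2
      change m.2.card = k
      rw [hm2, Finset.card_compl, Fintype.card_fin, hT']
      omega) (hγ T)
  refine ⟨⟨⟨Γ, hΓ1⟩, hΓ2⟩, rightHom_ext ht fun T hT => ?_⟩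
  have hv := (isVolumeForm (q := q) ht).1.1
  apply hv
  apply Subtype.ext
  refine (mul_ι_ell (isVolumeForm (q := q) ht) hk _ _).trans ?_
  apply Subtype.ext
  change Γ * mono (relMatrix q) t (indicator T, T) =
    mono _ _ V * toForms q t (φ.1 (basicForm ht T hT))
  have hrT : r T = φ.1 (basicForm ht T hT) := dif_pos hT
  rw [← hrT, ← hγV T, Finset.sum_mul, Finset.sum_eq_single T]
  · -- the summand of another set of the same size meets `T`, so its product with `θ_T` is zero
    intro T' hT' hne
    have hcard := (Finset.mem_powersetCard.1 hT').2
    refine map_eq_of_mono (φ := LinearMap.mulRight F (mono (relMatrix q) t (indicator T, T)))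
      (ψ := 0) (fun m hm => ?_) (hγ T')
    have hm2 : m.2 = T'ᶜ := hm.2
    have hd : ¬ Disjoint m.2 T := by
      rw [hm2]
      intro hd
      have hsub : T ⊆ T' := by simpa using (Finset.subset_compl_iff_disjoint_left).2 hd
      exact hne (Finset.eq_of_subset_of_card_le hsub (by rw [hcard, hT])).symm
    rw [LinearMap.mulRight_apply, mono_mul_mono]
    simp [structConst, hd]
  · intro h
    exact absurd (Finset.mem_powersetCard.2 ⟨Finset.subset_univ T, hT⟩) h

theorem isIntegrable_calculus (ht : t ≠ 1) : (calculus q t ht).IsIntegrable n :=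
  ⟨_, isVolumeForm ht, fun _ hk => ⟨ell_injective ht hk, ell_surjective ht hk⟩⟩


/-! ### The Gelfand-Kirillov dimension -/

/-- The indices of the monomials of degree `0` in which every `xᵢ` occurs at most `s` times. -/
def boundedIdx (n s : ℕ) : Set (MonoIdx n) := {m | m.2 = ∅ ∧ ∀ i, m.1 i ≤ s}

variable (F q) in
/-- The span of the monomials in which every generator occurs at most `s` times. -/
noncomputable def boundedSpan (s : ℕ) : Submodule F (QuantumAffineSpace F n q) :=
  (spanOn (relMatrix q) 1 (boundedIdx n s)).comap (toForms q 1).toLinearMap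

theorem mem_boundedSpan {s : ℕ} {r : QuantumAffineSpace F n q} :
    r ∈ boundedSpan F q s ↔ toForms q 1 r ∈ spanOn (relMatrix q) 1 (boundedIdx n s) := Iff.rfl

theorem boundedSpan_mono {s s' : ℕ} (h : s ≤ s') : boundedSpan F q s ≤ boundedSpan F q s' :=
  fun _ hr => spanOn_mono (s := boundedIdx n s) (s' := boundedIdx n s')
    (fun _ hm => ⟨hm.1, fun i => (hm.2 i).trans h⟩) hr

theorem one_mem_boundedSpan (s : ℕ) : (1 : QuantumAffineSpace F n q) ∈ boundedSpan F q s := by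
  rw [mem_boundedSpan, map_one, one_def]
  exact mono_mem_spanOn ⟨rfl, fun _ => Nat.zero_le _⟩

theorem mul_mem_boundedSpan {s s' : ℕ} {r r' : QuantumAffineSpace F n q}
    (h : r ∈ boundedSpan F q s) (h' : r' ∈ boundedSpan F q s') :
    r * r' ∈ boundedSpan F q (s + s') := by
  rw [mem_boundedSpan] at *
  rw [map_mul]
  refine mul_mem_spanOn (s := boundedIdx n s) (s' := boundedIdx n s')
    (s'' := boundedIdx n (s + s'))
    (fun m hm m' hm' _ => ⟨?_, fun i => ?_⟩) h h'
  · simp [idxMul, hm.1, hm'.1]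
  · exact Nat.add_le_add (hm.2 i) (hm'.2 i)

theorem exists_mem_boundedSpan (r : QuantumAffineSpace F n q) : ∃ s, r ∈ boundedSpan F q s := by
  refine ⟨(coeff (toForms q 1 r)).support.sup fun m => Finset.univ.sup m.1, ?_⟩
  refine mem_spanOn_iff.2 fun m hm => ⟨mem_spanOn_iff.1 (toForms_mem_spanOn r) m hm, fun i => ?_⟩
  exact (Finset.le_sup (f := m.1) (Finset.mem_univ i)).trans
    (Finset.le_sup (f := fun m : MonoIdx n => Finset.univ.sup m.1) (Finsupp.mem_support_iff.2 hm))

theorem exists_le_boundedSpan {V : Submodule F (QuantumAffineSpace F n q)} (hV : V.FG) :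
    ∃ s, V ≤ boundedSpan F q s := by
  obtain ⟨X, rfl⟩ := hV
  choose b hb using exists_mem_boundedSpan (F := F) (q := q)
  exact ⟨X.sup b, Submodule.span_le.2 fun r hr => boundedSpan_mono (Finset.le_sup hr) (hb r)⟩

theorem wordSpan_le_boundedSpan {V : Submodule F (QuantumAffineSpace F n q)} {s : ℕ}
    (hV : V ≤ boundedSpan F q s) (m : ℕ) : wordSpan F V m ≤ boundedSpan F q (s * m) := by
  have h1 : 1 ⊔ V ≤ boundedSpan F q s := sup_le (Submodule.one_le.2 (one_mem_boundedSpan s)) hV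
  induction m with
  | zero => exact Submodule.one_le.2 (one_mem_boundedSpan _)
  | succ m ih =>
    rw [wordSpan, pow_succ]
    exact Submodule.mul_le.2 fun r hr r' hr' => mul_mem_boundedSpan (ih hr) (h1 hr')

variable (F q) in
/-- The coefficients of the monomials in which every generator occurs at most `s` times. -/
noncomputable def boundedCoeff (s : ℕ) :
    boundedSpan F q s →ₗ[F] ((Fin n → Fin (s + 1)) → F) where
  toFun r a := coeff (toForms q 1 (r : QuantumAffineSpace F n q)) (fun i => (a i : ℕ), ∅)
  map_add' r r' := by ext; simp
  map_smul' c r := by ext; simp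

variable (F q) in
theorem boundedCoeff_injective (s : ℕ) : Function.Injective (boundedCoeff F q s) := by
  refine (injective_iff_map_eq_zero _).2 fun r hr => ?_
  apply Subtype.ext
  apply toForms_injective q 1
  apply coeff.injective
  ext ⟨a, S⟩
  by_contra hne
  have hm := mem_spanOn_iff.1 (mem_boundedSpan.1 r.2) (a, S) (fun h => hne (by simpa using h))
  obtain rfl : S = ∅ := hm.1
  have := congrFun hr fun i => ⟨a i, Nat.lt_succ_of_le (hm.2 i)⟩
  exact hne (by simpa [boundedCoeff] using this)

instance (s : ℕ) : Module.Finite F (boundedSpan F q s) :=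
  Module.Finite.of_injective _ (boundedCoeff_injective F q s)

theorem finrank_wordSpan_le {V : Submodule F (QuantumAffineSpace F n q)} {s : ℕ}
    (hV : V ≤ boundedSpan F q s) (m : ℕ) :
    Module.finrank F (wordSpan F V m) ≤ (s * m + 1) ^ n := by
  refine (Submodule.finrank_mono (wordSpan_le_boundedSpan hV m)).trans ?_
  refine (LinearMap.finrank_le_finrank_of_injective (boundedCoeff_injective F q (s * m))).trans ?_
  simp

variable (F q) in
/-- The `(s + 1) ^ n` monomials in which every generator occurs at most `s` times have total degree
at most `n s`. -/
theorem pow_le_finrank_wordSpan (m s : ℕ) (h : n * s ≤ m) :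
    (s + 1) ^ n ≤
      Module.finrank F (wordSpan F (Submodule.span F (Set.range (x F n q))) m) := by
  set W := wordSpan F (Submodule.span F (Set.range (x F n q))) m with hW
  have hfin : Module.Finite F W := by
    obtain ⟨b, hb⟩ := exists_le_boundedSpan (F := F) (q := q)
      (Submodule.fg_span (R := F) (Set.finite_range (x F n q)))
    exact Submodule.finiteDimensional_of_le (wordSpan_le_boundedSpan hb m)
  have hmem : ∀ a : Fin n → Fin (s + 1),
      ∃ r : W, toForms q 1 (r : QuantumAffineSpace F n q) =
        mono (relMatrix q) 1 (fun i => (a i : ℕ), ∅) := by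
    intro a
    obtain ⟨r, hr, hra⟩ := mono_mem_map_wordSpan (q := q) (t := 1) (m := m)
      (a := fun i => (a i : ℕ)) (by
        refine le_trans ?_ h
        refine (Finset.sum_le_card_nsmul _ _ s fun i _ => Nat.lt_succ_iff.1 (a i).2).trans ?_
        simp)
    exact ⟨⟨r, hr⟩, hra⟩
  choose r hr using hmem
  have hli : LinearIndependent F r := by
    rw [Fintype.linearIndependent_iff]
    intro g hg a
    have h0 := congrArg (fun w : W => coeff (toForms q 1 (w : QuantumAffineSpace F n q))
      (fun i => (a i : ℕ), ∅)) hg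
    have hinj : ∀ b : Fin n → Fin (s + 1),
        ((fun i => (b i : ℕ)) = fun i => (a i : ℕ)) ↔ b = a := fun b =>
      ⟨fun h => funext fun i => Fin.ext (congrFun h i), fun h => by rw [h]⟩
    simpa [hr, coeff_mono, Finsupp.single_apply, Prod.ext_iff, hinj] using h0
  have := hli.fintype_card_le_finrank
  simpa using this

/-- If `(c m) ^ n ≤ m ^ e` for all large `m`, with `c > 0`, then `n ≤ e`. -/
theorem le_of_eventually_pow_le_rpow {c e : ℝ} (hc : 0 < c) {k : ℕ}
    (h : ∀ᶠ m : ℕ in atTop, (c * (m : ℝ)) ^ k ≤ (m : ℝ) ^ e) : (k : ℝ) ≤ e := by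
  by_contra! hlt
  have h1 : Tendsto (fun m : ℕ => (m : ℝ) ^ ((k : ℝ) - e)) atTop atTop :=
    (tendsto_rpow_atTop (sub_pos.2 hlt)).comp tendsto_natCast_atTop_atTop
  obtain ⟨m, hm, hm1, hm0⟩ := (h.and ((h1.eventually_gt_atTop (c⁻¹ ^ k)).and
    (eventually_gt_atTop 0))).exists
  have hpos : (0 : ℝ) < m := by exact_mod_cast hm0
  rw [Real.rpow_sub hpos, Real.rpow_natCast, lt_div_iff₀ (Real.rpow_pos_of_pos hpos e)] at hm1
  have h2 : c⁻¹ ^ k * (c * (m : ℝ)) ^ k = (m : ℝ) ^ k := by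
    rw [← mul_pow, ← mul_assoc, inv_mul_cancel₀ hc.ne', one_mul]
  have h3 : c⁻¹ ^ k * (c * (m : ℝ)) ^ k ≤ c⁻¹ ^ k * (m : ℝ) ^ e :=
    mul_le_mul_of_nonneg_left hm (by positivity)
  linarith

/-- A polynomial bound of degree `k` is eventually below `m ^ e` for every `e > k`. -/
theorem eventually_pow_le_rpow {e : ℝ} {k : ℕ} (h : (k : ℝ) < e) (s : ℕ) :
    ∀ᶠ m : ℕ in atTop, (((s * m + 1) ^ k : ℕ) : ℝ) ≤ (m : ℝ) ^ e := by
  have h1 : Tendsto (fun m : ℕ => (m : ℝ) ^ (e - k)) atTop atTop :=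
    (tendsto_rpow_atTop (sub_pos.2 h)).comp tendsto_natCast_atTop_atTop
  filter_upwards [h1.eventually_ge_atTop (((s : ℝ) + 1) ^ k), eventually_gt_atTop 0] with m hm hm0
  have hpos : (0 : ℝ) < m := by exact_mod_cast hm0
  have hm1 : (1 : ℝ) ≤ m := by exact_mod_cast hm0
  calc (((s * m + 1) ^ k : ℕ) : ℝ) = ((s : ℝ) * m + 1) ^ k := by push_cast; rfl
    _ ≤ (((s : ℝ) + 1) * m) ^ k := by
        refine pow_le_pow_left₀ (by positivity) ?_ k
        linarith [add_mul (s : ℝ) 1 m]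
    _ = ((s : ℝ) + 1) ^ k * (m : ℝ) ^ k := mul_pow _ _ _
    _ ≤ (m : ℝ) ^ (e - k) * (m : ℝ) ^ k := by gcongr
    _ = (m : ℝ) ^ e := by
        rw [← Real.rpow_natCast, ← Real.rpow_add hpos, sub_add_cancel]

variable (F q) in
theorem GKdim_eq (hn : 1 ≤ n) : GKdim F (QuantumAffineSpace F n q) = (n : EReal) := by
  apply le_antisymm
  · refine iSup₂_le fun V hV => ?_
    obtain ⟨s, hs⟩ := exists_le_boundedSpan hV
    refine EReal.le_of_forall_lt_iff_le.1 fun e he => ?_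
    have he' : (n : ℝ) < e := by exact_mod_cast he
    refine iInf₂_le e ?_
    filter_upwards [eventually_pow_le_rpow he' s] with m hm
    exact le_trans (by exact_mod_cast finrank_wordSpan_le hs m) hm
  · refine le_trans ?_ (le_iSup₂ (f := fun (V : Submodule F (QuantumAffineSpace F n q))
      (_ : V.FG) => growthExponent F V) (Submodule.span F (Set.range (x F n q)))
      (Submodule.fg_span (Set.finite_range _)))
    refine le_iInf₂ fun e he => ?_
    have hn0 : (0 : ℝ) < n := by exact_mod_cast hn
    suffices h : (n : ℝ) ≤ e by exact_mod_cast h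
    refine le_of_eventually_pow_le_rpow (c := (n : ℝ)⁻¹) (by positivity) ?_
    filter_upwards [he] with m hm
    refine le_trans ?_ hm
    have h1 := pow_le_finrank_wordSpan F q m (m / n) (Nat.mul_div_le m n)
    -- `(m / n + 1) ^ n` monomials, with the quotient rounded down, dominate the real `(m / n) ^ n`
    refine le_trans ?_ (Nat.cast_le.2 h1)
    rw [Nat.cast_pow]
    refine pow_le_pow_left₀ (by positivity) ?_ n
    rw [inv_mul_le_iff₀ hn0]
    exact_mod_cast (Nat.lt_mul_div_succ m hn).le

variable (F q) in
theorem finiteType : Algebra.FiniteType F (QuantumAffineSpace F n q) := by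
  refine ⟨⟨(Set.finite_range (x F n q)).toFinset, ?_⟩⟩
  rw [Set.Finite.coe_toFinset, adjoin_range_x]

end QuantumAffineSpace

/-- Over a field in which some nonzero element is not a root of unity (for instance any field of
characteristic zero), the quantum affine space is differentially smooth, and it is an iterated
skew-polynomial ring `F[x₁][x₂; σ₂]⋯[xₙ; σₙ]` with `σₖ(xᵢ) = qᵢ⁻¹ xᵢ`. -/
theorem mainTheorem6 (F : Type u) [Field F] (hF : ∃ t : Fˣ, ∀ m : ℕ, 0 < m → t ^ m ≠ 1)
    (n : ℕ) (hn : 1 ≤ n) (q : Fin (n - 1) → Fˣ) :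
    DifferentiallySmooth F (QuantumAffineSpace F n q) ∧
    (Function.Injective (Polynomial.aeval (R := F) (QuantumAffineSpace.x F n q ⟨0, hn⟩)) ∧
      (Polynomial.aeval (R := F) (QuantumAffineSpace.x F n q ⟨0, hn⟩)).range =
        QuantumAffineSpace.initial F n q 1) ∧
    (∀ (k : ℕ) (_ : 1 ≤ k) (hkn : k < n),
      ∃ σ : QuantumAffineSpace.initial F n q k ≃ₐ[F] QuantumAffineSpace.initial F n q k,
        (∀ (i : Fin n) (hi : i.val < k) (y : QuantumAffineSpace.initial F n q k),
          (y : QuantumAffineSpace F n q) = QuantumAffineSpace.x F n q i →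
            σ y = (((q ⟨i.val, by omega⟩)⁻¹ : Fˣ) : F) • y) ∧
        IsSkewPolynomialRing (QuantumAffineSpace.initial F n q k) σ
          (QuantumAffineSpace.x F n q ⟨k, hkn⟩) (QuantumAffineSpace.initial F n q (k + 1))) ∧
    QuantumAffineSpace.initial F n q n = ⊤ := by
  obtain ⟨t, ht⟩ := hF
  have ht1 : t ≠ 1 := by simpa using ht 1 one_pos
  refine ⟨⟨QuantumAffineSpace.finiteType F q, n, QuantumAffineSpace.GKdim_eq F q hn, _, _, _,
    QuantumAffineSpace.calculus q t ht1, QuantumAffineSpace.isConnected_calculus ht1 ht,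
    QuantumAffineSpace.hasDimension_calculus ht1, QuantumAffineSpace.isIntegrable_calculus ht1⟩,
    ⟨QuantumAffineSpace.aeval_x_injective _, ?_⟩, fun k _ hkn => ?_,
    QuantumAffineSpace.initial_eq_top F n q⟩
  · rw [QuantumAffineSpace.initial_one F n q hn, Algebra.adjoin_singleton_eq_range_aeval]
  · refine ⟨QuantumAffineSpace.scaleInitial (QuantumAffineSpace.twistScalar q) k,
      fun i hi y hy => ?_, QuantumAffineSpace.isSkewPolynomialRing hkn⟩
    apply Subtype.ext
    rw [QuantumAffineSpace.coe_scaleInitial, hy, QuantumAffineSpace.scale_x,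
      QuantumAffineSpace.twistScalar, dif_pos (by omega), Subalgebra.coe_smul, hy]
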